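/- **Setting.** Let $\mathsf k$ be a field, $M$ a lattice (finitely generated free abelian group), $M_{\mathbb R}=\mathbb R\otimes M$, and let $C\subset M_{\mathbb R}$ be a pointed (containing no line) full-dimensional rational polyhedral cone, i.e. the set of non-negative real combinations of a finite subset of $M$. Let $R=\mathsf k[C\cap M]=\mathrm{Span}_{\mathsf k}\{x^m \mid m\in C\cap M\}\subset \mathsf k[M]$ be the associated toric algebra, and let $\Sigma_1$ be the finite set of primitive generators, in $N=\mathrm{Hom}_{\mathbb Z}(M,\mathbb Z)$, of the extremal rays of the dual cone of $C$. For $v\in M_{\mathbb R}$ let $A_v=\mathrm{Span}_{\mathsf k}\{x^m\mid m\in M\cap (C+v)\}$ (conic module) and $\mathring A_v=\mathrm{Span}_{\mathsf k}\{x^m\mid m\in M\cap (\mathring C+v)\}$ (open conic module), where $\mathring C$ is the interior of $C$; both are $M$-graded $R$-submodules of $\mathsf k[M]$. The chamber of constancy of $v$ is $\Delta=\{w\in M_{\mathbb R}\mid A_w=A_v\}$, and one writes $A_\Delta=A_v$. Put $d_n=\lceil\langle v,n\rangle\rceil$ for $n\in\Sigma_1$. The open cells of $\Delta$ are the non-empty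 sets $$\tau_\Omega=\{x\in M_{\mathbb R}\mid d_n-1<\langle x,n\rangle<d_n \text{ for } n\in\Omega,\ \langle x,n\rangle=d_n\text{ for } n\in\Sigma_1\setminus\Omega\},\qquad \Omega\subseteq\Sigma_1.$$ For a cell $\tau$ of $\Delta$ put $\mathring A_\tau=\mathring A_w$ for any $w\in\tau$. Fix an arbitrary orientation of every cell of $\Delta$. Let $K_\Delta^\bullet$ be the complex of $M$-graded $R$-modules whose term in homological degree $i\ge 0$ is $\bigoplus_{\tau}\mathring A_\tau$, over the cells $\tau$ of $\Delta$ of codimension $i$ (and zero in negative degrees), and whose differential has as component $\mathring A_{\tau'}\to\mathring A_\tau$ (with $\operatorname{codim}\tau'=\operatorname{codim}\tau+1$) the inclusion multiplied by a sign if $\mathring A_{\tau'}\subseteq\mathring A_\tau$, and zero otherwise. The sign is $+1$ if the orientation of $\tau'$ agrees with the one induced by $\tau$ on its boundary component $\tau'$, and $-1$ otherwise. **Lemma 5.2 (Acyclicity Lemma).** Let $A_\Delta$ and $A_{\Delta'}$ be two conic modules for $R$, with chambers of constancy $\Delta$ and $\Delta'$. Then $K_\Delta^\bullet$ is a complex,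 and: 1. If $A_\Delta\not\simeq A_{\Delta'}$ as $R$-modules, the complex $\mathrm{Hom}_R(A_{\Delta'},K_\Delta^\bullet)$ is exact (its homology vanishes in every degree, including degree $0$). 2. If $A_\Delta\simeq A_{\Delta'}$, there is a unique $m\in M$ with $\Delta=m+\Delta'$. In this case the homology of $\mathrm{Hom}_R(A_{\Delta'},K_\Delta^\bullet)$ is one-dimensional over $\mathsf k$, and it appears only in homological degree $0$ and in $M$-degree $m$. -/

import Mathlib

open Module

noncomputable section

namespace ConicAcyclicity

/-- A pointed full-dimensional rational polyhedral cone in the real vector space `E = M_ℝ`, where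
`M = L` is a lattice in `E`: all non-negative real combinations of a finite set of elements
of the lattice, spanning `E` and containing no line. -/
structure ToricCone {E : Type*} [NormedAddCommGroup E] [NormedSpace ℝ E]
    (L : Submodule ℤ E) where
  cone : PointedCone ℝ E
  rational : ∃ S : Set E, S.Finite ∧ S ⊆ (L : Set E) ∧ cone = PointedCone.hull ℝ S
  full_dim : Submodule.span ℝ (cone : Set E) = ⊤
  pointed : ∀ x ∈ cone, -x ∈ cone → x = 0

variable {E : Type*} [NormedAddCommGroup E] [NormedSpace ℝ E] {L : Submodule ℤ E}

/-- The linear forms that belong to the dual lattice `N = Hom_ℤ(M, ℤ)`. -/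
def IsIntegral (L : Submodule ℤ E) (n : Dual ℝ E) : Prop :=
  ∀ m ∈ L, ∃ z : ℤ, n m = z

/-- The dual cone `σ` of `C`. -/
def ToricCone.dualCone (C : ToricCone L) : PointedCone ℝ (Dual ℝ E) :=
  PointedCone.dual (Dual.eval ℝ E) (C.cone : Set E)

/-- The set `Σ₁` of primitive generators of the extremal rays of the dual cone `σ`, that is,
the primitive inward-pointing normals to the facets of `C`. -/
def ToricCone.normals (C : ToricCone L) : Set (Dual ℝ E) :=
  {n | n ∈ C.dualCone ∧ IsIntegral L n ∧ (∀ ε : ℝ, 0 < ε → ε < 1 → ¬ IsIntegral L (ε • n)) ∧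
    IsExtreme ℝ (C.dualCone : Set (Dual ℝ E)) {y | ∃ c : ℝ, 0 ≤ c ∧ y = c • n}}

theorem ToricCone.mem_dualCone (C : ToricCone L) (n : Dual ℝ E) :
    n ∈ C.dualCone ↔ ∀ x ∈ C.cone, 0 ≤ n x := by
  simp [ToricCone.dualCone]

theorem ToricCone.finite_normals (C : ToricCone L) : C.normals.Finite := by
  obtain ⟨S, hS, -, hC⟩ := C.rational
  have hdual : ∀ n : Dual ℝ E, n ∈ C.dualCone ↔ ∀ s ∈ S, 0 ≤ n s := by
    intro n
    rw [C.mem_dualCone]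
    constructor
    · intro h s hs
      exact h s (by rw [hC]; exact Submodule.subset_span hs)
    · intro h x hx
      rw [hC] at hx
      induction hx using Submodule.span_induction with
      | mem x hx => exact h x hx
      | zero => simp
      | add x y _ _ hx hy => rw [map_add]; exact add_nonneg hx hy
      | smul a x _ hx =>
        rw [← Nonneg.coe_smul, map_smul]
        exact mul_nonneg a.2 hx
  refine Set.Finite.of_finite_image (f := fun n : Dual ℝ E => {s | s ∈ S ∧ n s = 0})
    (hS.finite_subsets.subset ?_) ?_
  · rintro _ ⟨n, -, rfl⟩
    exact fun s hs => hs.1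
  · rintro n ⟨hn, hnI, hnP, hnE⟩ n' ⟨hn', hnI', hnP', -⟩ heq
    have key : ∃ ε : ℝ, 0 < ε ∧ ∀ s ∈ S, ε * n' s ≤ n s := by
      have h1 : ∀ᶠ ε : ℝ in nhdsWithin 0 (Set.Ioi 0), ∀ s ∈ S, ε * n' s ≤ n s := by
        rw [Filter.eventually_all_finite hS]
        intro s hs
        rcases ((hdual n).1 hn s hs).eq_or_lt with h0 | h0
        · have : s ∈ {s | s ∈ S ∧ n' s = 0} := by
            rw [← show _ = {s | s ∈ S ∧ n' s = 0} from heq]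
            exact ⟨hs, h0.symm⟩
          simp [this.2, ← h0]
        · have hc : Filter.Tendsto (fun ε : ℝ => ε * n' s) (nhdsWithin 0 (Set.Ioi 0))
              (nhds (0 * n' s)) :=
            (tendsto_nhdsWithin_of_tendsto_nhds Filter.tendsto_id).mul_const _
          rw [zero_mul] at hc
          exact (hc.eventually_lt_const h0).mono fun _ h => h.le
      obtain ⟨ε, hε, h2⟩ := (h1.and self_mem_nhdsWithin).exists
      exact ⟨ε, h2, hε⟩
    obtain ⟨ε, hε, hle⟩ := key
    have hx : (2 * ε) • n' ∈ (C.dualCone : Set (Dual ℝ E)) := by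
      refine (hdual _).2 fun s hs => ?_
      have := (hdual n').1 hn' s hs
      simp only [LinearMap.smul_apply, smul_eq_mul]
      positivity
    have hy : (2 : ℝ) • (n - ε • n') ∈ (C.dualCone : Set (Dual ℝ E)) := by
      refine (hdual _).2 fun s hs => ?_
      have := hle s hs
      simp only [LinearMap.smul_apply, LinearMap.sub_apply, smul_eq_mul]
      linarith
    obtain ⟨c, hc, hcn⟩ := hnE.left_mem_of_mem_openSegment hx hy
      (z := n) ⟨1, zero_le_one, (one_smul _ _).symm⟩
      ⟨1 / 2, 1 / 2, by norm_num, by norm_num, by norm_num, by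
        ext s
        simp only [LinearMap.smul_apply, LinearMap.add_apply, LinearMap.sub_apply, smul_eq_mul]
        ring⟩
    have hn'c : n' = (c / (2 * ε)) • n := by
      rw [div_eq_inv_mul, mul_smul, ← hcn, smul_smul, inv_mul_cancel₀ (by positivity), one_smul]
    set a := c / (2 * ε) with ha
    have ha0 : 0 ≤ a := by positivity
    rcases ha0.eq_or_lt with h0 | h0
    · exfalso
      refine hnP' (1 / 2) (by norm_num) (by norm_num) fun m _ => ⟨0, ?_⟩
      simp [hn'c, ← h0]
    rcases lt_trichotomy a 1 with h1 | h1 | h1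
    · exact absurd (hn'c ▸ hnI') (hnP a h0 h1)
    · rw [hn'c, h1, one_smul]
    · refine absurd ?_ (hnP' a⁻¹ (by positivity) (inv_lt_one_of_one_lt₀ h1))
      rwa [hn'c, smul_smul, inv_mul_cancel₀ h0.ne', one_smul]

instance (C : ToricCone L) : Finite C.normals := C.finite_normals

section Modules

variable (k : Type*) [Field k]

/-- The toric algebra `R = k[C ∩ M]`: the subalgebra of the Laurent ring `k[M]` spanned by the
monomials `x ^ m` with `m ∈ M ∩ C`. -/
def toricAlgebra (C : ToricCone L) : Subalgebra k (AddMonoidAlgebra k L) where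
  carrier := {f | ∀ m ∈ f.coeff.support, (m : E) ∈ C.cone}
  mul_mem' {f g} hf hg m hm := by
    classical
    obtain ⟨a, ha, b, hb, rfl⟩ := Finset.mem_add.1 (AddMonoidAlgebra.support_coeff_mul_subset f g hm)
    exact C.cone.add_mem (hf a ha) (hg b hb)
  add_mem' {f g} hf hg m hm := by
    classical
    rcases Finset.mem_union.1 (Finsupp.support_add hm) with h | h
    exacts [hf m h, hg m h]
  algebraMap_mem' r m hm := by
    have : m = 0 := by
      simpa using Finsupp.support_single_subset (a := (0 : L)) (b := r) hm
    simp [this]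

/-- The `R`-submodule of `k[M]` spanned by the monomials `x ^ m` with `m ∈ P`, for a set `P` of
lattice points that is stable under adding lattice points of `C`. -/
def monomialModule (C : ToricCone L) (P : Set L)
    (hP : ∀ r m : L, (r : E) ∈ C.cone → m ∈ P → r + m ∈ P) :
    Submodule (toricAlgebra k C) (AddMonoidAlgebra k L) where
  carrier := {f | ∀ m ∈ f.coeff.support, m ∈ P}
  zero_mem' := by simp
  add_mem' {f g} hf hg m hm := by
    classical
    rcases Finset.mem_union.1 (Finsupp.support_add hm) with h | h
    exacts [hf m h, hg m h]
  smul_mem' r f hf m hm := by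
    classical
    obtain ⟨a, ha, b, hb, rfl⟩ :=
      Finset.mem_add.1 (AddMonoidAlgebra.support_coeff_mul_subset (r : AddMonoidAlgebra k L) f hm)
    exact hP a b (r.2 a ha) (hf b hb)

/-- The conic module `A_v`, spanned by the `x ^ m` with `m ∈ M ∩ (C + v)`. -/
def conicModule (C : ToricCone L) (v : E) :
    Submodule (toricAlgebra k C) (AddMonoidAlgebra k L) :=
  monomialModule k C {m | (m : E) - v ∈ C.cone} fun r m hr hm => by
    have := C.cone.add_mem hr hm
    simpa [add_sub_assoc] using this

theorem ToricCone.add_mem_interior (C : ToricCone L) {r x : E} (hr : r ∈ C.cone)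
    (hx : x ∈ interior (C.cone : Set E)) : r + x ∈ interior (C.cone : Set E) := by
  have h : (fun y => r + y) '' interior (C.cone : Set E) ⊆ interior (C.cone : Set E) := by
    refine interior_maximal ?_ ((Homeomorph.addLeft r).isOpenMap _ isOpen_interior)
    rintro _ ⟨y, hy, rfl⟩
    exact C.cone.add_mem hr (interior_subset hy)
  exact h ⟨x, hx, rfl⟩

/-- The open conic module `Å_v`, spanned by the `x ^ m` with `m` in `M` and in the interior of
`C + v`. -/
def openConicModule (C : ToricCone L) (v : E) :
    Submodule (toricAlgebra k C) (AddMonoidAlgebra k L) :=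
  monomialModule k C {m | (m : E) - v ∈ interior (C.cone : Set E)} fun r m hr hm => by
    have := C.add_mem_interior hr hm
    simpa [add_sub_assoc] using this

end Modules

section Instances

variable (k : Type*) [Field k] (C : ToricCone L)

instance : CommRing (toricAlgebra k C) := (toricAlgebra k C).toCommRing

instance : Module (toricAlgebra k C) (AddMonoidAlgebra k L) := Algebra.toModule

instance : IsScalarTower k (toricAlgebra k C) (AddMonoidAlgebra k L) :=
  Subalgebra.isScalarTower_mid _

variable {k C} (A : Submodule (toricAlgebra k C) (AddMonoidAlgebra k L))

instance : AddCommGroup A := A.addCommGroup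

instance : Module (toricAlgebra k C) A := A.module

instance : Module k A := A.module'

instance : SMul (toricAlgebra k C) A := Module.toDistribMulAction.toDistribSMul.toSMul

instance : SMul k A := Module.toDistribMulAction.toDistribSMul.toSMul

instance : IsScalarTower k (toricAlgebra k C) A := Submodule.isScalarTower' A

instance : SMulCommClass (toricAlgebra k C) k A := IsScalarTower.to_smulCommClass'

end Instances

/-- The chamber of constancy `Δ` containing `v`: the vectors `w` with
`(C + w) ∩ M = (C + v) ∩ M`, i.e. `A_w = A_v`. -/
def chamber (C : ToricCone L) (v : E) : Set E :=
  {w | ∀ m ∈ L, m - w ∈ C.cone ↔ m - v ∈ C.cone}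

/-- The set `τ_Ω` in the chamber of `v`: with `d_n = ⌈⟨v, n⟩⌉`, the points `x` such that
`d_n - 1 < ⟨x, n⟩ < d_n` for `n ∈ Ω` and `⟨x, n⟩ = d_n` for `n ∉ Ω`. -/
def cellSet (C : ToricCone L) (v : E) (Ω : Set C.normals) : Set E :=
  {x | (∀ n ∈ Ω, (⌈(n : Dual ℝ E) v⌉ : ℝ) - 1 < (n : Dual ℝ E) x ∧
      (n : Dual ℝ E) x < (⌈(n : Dual ℝ E) v⌉ : ℝ)) ∧
    ∀ n ∉ Ω, (n : Dual ℝ E) x = (⌈(n : Dual ℝ E) v⌉ : ℝ)}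

/-- The open cells of the chamber of `v`: the non-empty sets `τ_Ω`. These sets are pairwise
disjoint, so each cell comes from exactly one `Ω`. -/
structure Cell (C : ToricCone L) (v : E) where
  Ω : Set C.normals
  nonempty : (cellSet C v Ω).Nonempty

namespace Cell

variable {C : ToricCone L} {v : E}

instance : Finite (Cell C v) :=
  Finite.of_injective Cell.Ω fun a b h => by cases a; cases b; simp_all

/-- The underlying subset of `E`. -/
def carrier (τ : Cell C v) : Set E := cellSet C v τ.Ω

/-- The direction of the affine span of a cell. -/
def dir (τ : Cell C v) : Submodule ℝ E := vectorSpan ℝ τ.carrier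

/-- The codimension of a cell. -/
def codim (τ : Cell C v) : ℕ := finrank ℝ E - finrank ℝ τ.dir

/-- A vector lying in the cell. -/
def point (τ : Cell C v) : E := τ.nonempty.some

/-- The open conic module `Å_τ`, which is `Å_w` for any vector `w` in the cell `τ`. -/
def openModule (k : Type*) [Field k] (τ : Cell C v) :
    Submodule (toricAlgebra k C) (AddMonoidAlgebra k L) :=
  openConicModule k C τ.point

end Cell

/-- A choice of an orientation of every cell of the chamber of `v`. -/
abbrev CellOrientations (C : ToricCone L) (v : E) :=
  ∀ τ : Cell C v, Orientation ℝ τ.dir (Fin (finrank ℝ τ.dir))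

/-- For a cell `τ'` that is a boundary component of codimension one of the cell `τ`: the chosen
orientation of `τ'` is the one induced by the chosen orientation of `τ` (outward vector first).
Here the orientations of `τ` and `τ'` are represented by volume forms `ω` and `ω'`, the vector
`u = x' - x` with `x ∈ τ` and `x' ∈ τ'` points out of `τ`, and
`ω (u, w'₀, w'₁, …) = ω' (w'₀, w'₁, …)`. -/
def OrientationAgrees {C : ToricCone L} {v : E} (o : CellOrientations C v) (τ' τ : Cell C v) :
    Prop :=
  ∃ x ∈ τ.carrier, ∃ x' ∈ τ'.carrier,
    ∃ (ω : τ.dir [⋀^Fin (finrank ℝ τ.dir)]→ₗ[ℝ] ℝ) (hω : ω ≠ 0)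
      (ω' : τ'.dir [⋀^Fin (finrank ℝ τ'.dir)]→ₗ[ℝ] ℝ) (hω' : ω' ≠ 0),
      rayOfNeZero ℝ ω hω = o τ ∧ rayOfNeZero ℝ ω' hω' = o τ' ∧
      ∀ (w : Fin (finrank ℝ τ.dir) → τ.dir) (w' : Fin (finrank ℝ τ'.dir) → τ'.dir),
        (∀ j : Fin _, (j : ℕ) = 0 → (w j : E) = x' - x) →
        (∀ (i : Fin _) (j : Fin _), (j : ℕ) = (i : ℕ) + 1 → (w j : E) = w' i) →
        ω w = ω' w'

open Classical in
/-- The sign attached to a boundary component `τ'` of `τ`. -/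
def incidenceSign {C : ToricCone L} {v : E} (o : CellOrientations C v) (τ' τ : Cell C v) : ℤ :=
  if OrientationAgrees o τ' τ then 1 else -1

section Complex

variable (k : Type*) [Field k] {C : ToricCone L} {v : E}

/-- The term of `K_Δ` in homological degree `i`: the (finite) direct sum of the `Å_τ` over the
cells `τ` of codimension `i`. -/
abbrev chainTerm (C : ToricCone L) (v : E) (i : ℕ) :=
  ∀ τ : {τ : Cell C v // τ.codim = i}, τ.1.openModule k

open Classical in
/-- The component `Å_τ' → Å_τ` of the differential: the signed inclusion if `Å_τ' ⊆ Å_τ`, and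
zero otherwise. -/
def chainComponent (o : CellOrientations C v) (τ' τ : Cell C v) :
    τ'.openModule k →ₗ[toricAlgebra k C] τ.openModule k :=
  if h : τ'.openModule k ≤ τ.openModule k then
    incidenceSign o τ' τ • Submodule.inclusion h
  else 0

instance (i : ℕ) : AddCommGroup (chainTerm k C v i) := Pi.addCommGroup

instance (i : ℕ) : Module (toricAlgebra k C) (chainTerm k C v i) := Pi.module _ _ _

instance (i : ℕ) : Module k (chainTerm k C v i) := Pi.module _ _ _

instance (i : ℕ) : SMul (toricAlgebra k C) (chainTerm k C v i) :=
  Module.toDistribMulAction.toDistribSMul.toSMul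

instance (i : ℕ) : SMul k (chainTerm k C v i) := Module.toDistribMulAction.toDistribSMul.toSMul

instance (i : ℕ) : IsScalarTower k (toricAlgebra k C) (chainTerm k C v i) := Pi.isScalarTower

instance (i : ℕ) : SMulCommClass (toricAlgebra k C) k (chainTerm k C v i) :=
  IsScalarTower.to_smulCommClass'

instance (i : ℕ) : Fintype {τ : Cell C v // τ.codim = i} := Fintype.ofFinite _

/-- The differential of `K_Δ` from homological degree `i + 1` to homological degree `i`. -/
def chainDiff (o : CellOrientations C v) (i : ℕ) :
    chainTerm k C v (i + 1) →ₗ[toricAlgebra k C] chainTerm k C v i where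
  toFun f τ := ∑ τ' : {τ : Cell C v // τ.codim = i + 1}, chainComponent k o τ'.1 τ.1 (f τ')
  map_add' f g := by
    funext τ
    refine (Finset.sum_congr rfl fun τ' _ => ?_).trans Finset.sum_add_distrib
    exact map_add (chainComponent k o τ'.1 τ.1) (f τ') (g τ')
  map_smul' r f := by
    funext τ
    refine (Finset.sum_congr rfl fun τ' _ => ?_).trans (Finset.smul_sum (r := r)
      (f := fun τ' : {τ : Cell C v // τ.codim = i + 1} =>
        chainComponent k o τ'.1 τ.1 (f τ'))).symm
    exact map_smul (chainComponent k o τ'.1 τ.1) r (f τ')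

/-- The term of `Hom_R(A_Δ', K_Δ)` in homological degree `i`, with `Δ` the chamber of `v` and
`Δ'` the chamber of `v'`. -/
abbrev homTerm (C : ToricCone L) (v v' : E) (i : ℕ) :=
  conicModule k C v' →ₗ[toricAlgebra k C] chainTerm k C v i

instance (v' : E) (i : ℕ) : AddCommGroup (homTerm k C v v' i) := LinearMap.addCommGroup

instance (v' : E) (i : ℕ) : Module k (homTerm k C v v' i) := LinearMap.module

/-- The differential of `Hom_R(A_Δ', K_Δ)`, composition with the differential of `K_Δ`. -/
def homDiff (o : CellOrientations C v) (v' : E) (i : ℕ) :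
    homTerm k C v v' (i + 1) →ₗ[k] homTerm k C v v' i where
  toFun f := chainDiff k o i ∘ₗ f
  map_add' f g := LinearMap.comp_add _ _ _
  map_smul' c f := by
    ext1 a
    exact LinearMap.map_smul_of_tower (chainDiff k o i) c (f a)

/-- The cycles of `Hom_R(A_Δ', K_Δ)`; the complex is zero in negative homological degrees. -/
def homCycles (o : CellOrientations C v) (v' : E) : ∀ i, Submodule k (homTerm k C v v' i)
  | 0 => ⊤
  | i + 1 => LinearMap.ker (homDiff k o v' i)

/-- The boundaries of `Hom_R(A_Δ', K_Δ)`. -/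
def homBoundaries (o : CellOrientations C v) (v' : E) (i : ℕ) :
    Submodule k (homTerm k C v v' i) :=
  LinearMap.range (homDiff k o v' i)

/-- The homology of `Hom_R(A_Δ', K_Δ)` in homological degree `i`. -/
abbrev homHomology (o : CellOrientations C v) (v' : E) (i : ℕ) :=
  homCycles k o v' i ⧸ (homBoundaries k o v' i).submoduleOf (homCycles k o v' i)

/-- The part of `M`-degree `n` of `Hom_R(A_Δ', K_Δ)` in homological degree `i`: the homomorphisms
that raise the `M`-degree of homogeneous elements by `n`. -/
def homGraded (C : ToricCone L) (v v' : E) (i : ℕ) (n : L) :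
    Submodule k (homTerm k C v v' i) where
  carrier := {f | ∀ (p : L) (a : conicModule k C v'),
    (a : AddMonoidAlgebra k L) ∈ AddMonoidAlgebra.grade k p →
      ∀ τ, (f a τ : AddMonoidAlgebra k L) ∈ AddMonoidAlgebra.grade k (p + n)}
  zero_mem' _ _ _ _ := Submodule.zero_mem _
  add_mem' hf hg p a ha τ := Submodule.add_mem _ (hf p a ha τ) (hg p a ha τ)
  smul_mem' c _ hf p a ha τ := Submodule.smul_mem _ c (hf p a ha τ)

/-- The part of `M`-degree `n` of the homology of `Hom_R(A_Δ', K_Δ)` in homological degree `i`: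
the classes of the cycles of `M`-degree `n`. -/
def homologyGraded (o : CellOrientations C v) (v' : E) (i : ℕ) (n : L) :
    Submodule k (homHomology k o v' i) :=
  ((homGraded k C v v' i n).submoduleOf (homCycles k o v' i)).map
    ((homBoundaries k o v' i).submoduleOf (homCycles k o v' i)).mkQ

end Complex

end ConicAcyclicity

end

/-! The proof works with heights, the integers that the facet normals take on lattice points. The
normals cut out the cone (`ToricCone.mem_cone_iff`), and a lattice point can have any prescribed
height over one facet while being as high as desired over the others (`ToricCone.exists_height_eq`).
Hence conic and open conic modules are given by lower bounds on heights, and each bound is attained.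

A homomorphism from a conic module to a submodule of the Laurent ring is multiplication by a Laurent
polynomial (`exists_mul_of_hom`), so the Hom complex splits into strands indexed by degrees `m`. Let
`d`, `d'` be the ceilings of `v`, `v'` and `h` the height of `m`. The cell with index set `Ω` occurs
in the strand of `m` iff `d_n ≤ h_n + d'_n` for all `n`, with `n ∈ Ω` wherever equality holds. So
either no cell occurs, or exactly the cells with `A ⊆ Ω`, where `A` is the set of normals with
equality. All normals lie in `A` iff `x^m` carries `A_Δ'` onto `A_Δ`; such an `m` is unique, only
the top cell occurs, and this gives the one-dimensional homology.

In any other degree where cells occur, the strand is the cellular complex of the cells of `Δ` lying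
on no facet in `A`. A point of the interior of `m + Δ'` lies strictly between the walls for `n ∈ A`
and beyond the facets for all other `n`. This makes the strand exact (`exactOn_cellInterval`), by an
argument in the style of line shellings. Travel from that point to a generic point of the top cell.
The first wall crossed divides the cells into those on it and those off it; both halves are
instances of the same statement with fewer facets, and the recursion ends with two cells joined by a
sign.

That the differential squares to zero comes from the diamond property (`Cell.exists_diamond`) and
from the opposite signs of the two paths through a diamond (`Cell.incidenceSign_diamond`). -/

noncomputable section

namespace ConicAcyclicity

variable {E : Type*} [NormedAddCommGroup E] [NormedSpace ℝ E] {L : Submodule ℤ E}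

/-! ### Separation and integral linear forms -/

/-- Farkas' lemma for finitely generated cones. -/
theorem exists_dual_neg_of_notMem_hull {V ι : Type*} [AddCommGroup V] [Module ℝ V]
    (s : Finset ι) (y : ι → V) (x : V) (hx : x ∉ PointedCone.hull ℝ (y '' s)) :
    ∃ f : Dual ℝ V, (∀ i ∈ s, 0 ≤ f (y i)) ∧ f x < 0 := by
  classical
  induction s using Finset.induction_on generalizing y x with
  | empty =>
    have hx0 : x ≠ 0 := by
      rintro rfl
      exact hx (zero_mem _)
    obtain ⟨f, hf⟩ : ∃ f : Dual ℝ V, f x ≠ 0 := by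
      by_contra! h
      exact hx0 ((Module.forall_dual_apply_eq_zero_iff ℝ x).1 h)
    rcases hf.lt_or_gt with h | h
    · exact ⟨f, by simp, h⟩
    · exact ⟨-f, by simp, by simpa using h⟩
  | insert a s _ ih =>
    have hmem : ∀ i ∈ insert a s, y i ∈ PointedCone.hull ℝ (y '' (insert a s : Finset ι)) :=
      fun i hi => Submodule.subset_span ⟨i, hi, rfl⟩
    obtain ⟨f, hf, hfx⟩ := ih y x fun h => hx <| Submodule.span_mono
      (Set.image_mono (Finset.coe_subset.2 (Finset.subset_insert a s))) h
    rcases le_or_gt 0 (f (y a)) with ha | ha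
    · refine ⟨f, fun i hi => ?_, hfx⟩
      rcases Finset.mem_insert.1 hi with rfl | hi
      exacts [ha, hf i hi]
    -- Projection along `y a` onto `ker f`. Since `f (y a) < 0`, each `π (y i)` is `y i` plus a
    -- nonnegative multiple of `y a`, and `x` is `π x` plus another one; so `π x` in the projected
    -- cone would put `x` in the original one.
    let π : V →ₗ[ℝ] V := LinearMap.id - (f.smulRight ((f (y a))⁻¹ • y a))
    have hπ : ∀ z, π z = z - (f z * (f (y a))⁻¹) • y a := fun z => by simp [π, smul_smul]
    have hπx : π x ∉ PointedCone.hull ℝ ((π ∘ y) '' s) := by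
      intro h
      have hle : PointedCone.hull ℝ ((π ∘ y) '' s) ≤
          PointedCone.hull ℝ (y '' (insert a s : Finset ι)) := by
        refine Submodule.span_le.2 ?_
        rintro _ ⟨i, hi, rfl⟩
        have h1 := hmem i (Finset.mem_insert_of_mem hi)
        have h2 := (PointedCone.hull ℝ (y '' (insert a s : Finset ι))).smul_mem
          (show 0 ≤ -(f (y i) * (f (y a))⁻¹) by
            have := hf i hi
            have := inv_lt_zero.2 ha
            nlinarith) (hmem a (Finset.mem_insert_self _ _))
        have h3 := add_mem h1 h2
        simp only [Function.comp_apply, hπ, sub_eq_add_neg, ← neg_smul]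
        exact h3
      have h2 := (PointedCone.hull ℝ (y '' (insert a s : Finset ι))).smul_mem
          (show 0 ≤ f x * (f (y a))⁻¹ by
            have := inv_lt_zero.2 ha
            nlinarith) (hmem a (Finset.mem_insert_self _ _))
      have h3 := add_mem (hle h) h2
      rw [hπ] at h3
      refine hx ?_
      convert h3 using 1
      exact (sub_add_cancel _ _).symm
    obtain ⟨g, hg, hgx⟩ := ih (π ∘ y) (π x) hπx
    refine ⟨g ∘ₗ π, fun i hi => ?_, hgx⟩
    rcases Finset.mem_insert.1 hi with rfl | hi
    · have : π (y i) = 0 := by rw [hπ, mul_inv_cancel₀ ha.ne, one_smul, sub_self]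
      simp [this]
    · exact hg i hi

/-- An integral form that is not zero is a positive multiple of an integral form that takes the
value one on the lattice. -/
theorem IsIntegral.exists_primitive {f : Dual ℝ E} (hf : IsIntegral L f)
    (h0 : ∃ m ∈ L, f m ≠ 0) :
    ∃ h : ℝ, 0 < h ∧ IsIntegral L (h • f) ∧ ∃ m ∈ L, (h • f) m = 1 := by
  -- The values of `f` on `L` form a cyclic group; the scaling factor is the inverse of its positive
  -- generator.
  let H : AddSubgroup ℤ :=
    { carrier := {z | ∃ m ∈ L, f m = z}
      zero_mem' := ⟨0, L.zero_mem, by simp⟩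
      add_mem' := by
        rintro a b ⟨m, hm, ha⟩ ⟨n, hn, hb⟩
        exact ⟨m + n, L.add_mem hm hn, by push_cast; rw [map_add, ha, hb]⟩
      neg_mem' := by
        rintro a ⟨m, hm, ha⟩
        exact ⟨-m, L.neg_mem hm, by push_cast; rw [map_neg, ha]⟩ }
  obtain ⟨g, hg⟩ := Int.subgroup_cyclic H
  have hgm : g ∈ H := hg ▸ AddSubgroup.subset_closure rfl
  have hdvd : ∀ z ∈ H, ∃ c : ℤ, z = c * g := by
    intro z hz
    rw [hg, AddSubgroup.mem_closure_singleton] at hz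
    obtain ⟨c, rfl⟩ := hz
    exact ⟨c, by simp⟩
  have hg0 : g ≠ 0 := by
    rintro rfl
    obtain ⟨m, hm, hm0⟩ := h0
    obtain ⟨z, hz⟩ := hf m hm
    obtain ⟨c, hc⟩ := hdvd z ⟨m, hm, hz⟩
    simp [hz, hc] at hm0
  obtain ⟨p, hp, hpH⟩ : ∃ p : ℤ, 0 < p ∧ p ∈ H ∧ ∀ z ∈ H, ∃ c : ℤ, z = c * p := by
    rcases hg0.lt_or_gt with h | h
    · refine ⟨-g, by omega, H.neg_mem hgm, fun z hz => ?_⟩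
      obtain ⟨c, rfl⟩ := hdvd z hz
      exact ⟨-c, by ring⟩
    · exact ⟨g, h, hgm, hdvd⟩
  have hpR : (0 : ℝ) < p := by exact_mod_cast hp
  refine ⟨(p : ℝ)⁻¹, by positivity, fun m hm => ?_, ?_⟩
  · obtain ⟨z, hz⟩ := hf m hm
    obtain ⟨c, rfl⟩ := hpH.2 z ⟨m, hm, hz⟩
    refine ⟨c, ?_⟩
    simp only [LinearMap.smul_apply, hz, smul_eq_mul, Int.cast_mul]
    field_simp
  · obtain ⟨m, hm, hmp⟩ := hpH.1
    exact ⟨m, hm, by simp [hmp, hpR.ne']⟩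

/-- A finite set of lattice points on which a non-zero form vanishes is killed by a non-zero
integral form. -/
theorem exists_isIntegral_vanishing [FiniteDimensional ℝ E] [DiscreteTopology L] [IsZLattice ℝ L]
    (Z : Set E) (hZ : Z ⊆ L) (f : Dual ℝ E) (hf : f ≠ 0) (hfZ : ∀ z ∈ Z, f z = 0) :
    ∃ g : Dual ℝ E, IsIntegral L g ∧ (∃ m ∈ L, g m ≠ 0) ∧ ∀ z ∈ Z, g z = 0 := by
  have : Module.Finite ℤ L := ZLattice.module_finite ℝ L
  have : Module.Free ℤ L := ZLattice.module_free ℝ L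
  let b := Module.Free.chooseBasis ℤ L
  let B := b.ofZLatticeBasis ℝ L
  have hBb : ∀ i, B i = (b i : E) := fun i => b.ofZLatticeBasis_apply ℝ L i
  let K : Submodule ℤ L := Submodule.span ℤ {m : L | (m : E) ∈ Z}
  have hfK : ∀ m ∈ K, f (m : E) = 0 := by
    intro m hm
    induction hm using Submodule.span_induction with
    | mem x hx => exact hfZ _ hx
    | zero => simp
    | add x y _ _ hx hy => simp [hx, hy]
    | smul a x _ hx => simp [hx]
  obtain ⟨m0, hm0⟩ : ∃ m : L, f (m : E) ≠ 0 := by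
    by_contra! h
    exact hf (B.ext fun i => by simp [hBb, h])
  -- Modulo torsion, `L ⧸ K` is free and has enough integral forms. The class of `m0` survives
  -- because `f` vanishes on every element with a nonzero multiple in `K`.
  let T := Submodule.torsion ℤ (L ⧸ K)
  let Q := (L ⧸ K) ⧸ T
  let q : L →ₗ[ℤ] Q := T.mkQ ∘ₗ K.mkQ
  have hq : q m0 ≠ 0 := by
    intro h
    have h1 : K.mkQ m0 ∈ T := (Submodule.Quotient.mk_eq_zero T).1 h
    obtain ⟨a, ha⟩ := (Submodule.mem_torsion_iff _).1 h1
    have h2 : (a : ℤ) • m0 ∈ K := (Submodule.Quotient.mk_eq_zero K).1 ha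
    have h3 := hfK _ h2
    have ha0 : ((a : ℤ) : ℝ) ≠ 0 := by exact_mod_cast nonZeroDivisors.ne_zero a.2
    simp [ha0, hm0] at h3
  have : Module.Free ℤ Q := inferInstance
  obtain ⟨φ, hφ⟩ : ∃ φ : Dual ℤ Q, φ (q m0) ≠ 0 := by
    by_contra! h
    exact hq ((Module.forall_dual_apply_eq_zero_iff ℤ _).1 h)
  let g : Dual ℝ E := B.constr ℝ fun i => ((φ (q (b i)) : ℤ) : ℝ)
  have hg : ∀ m : L, g (m : E) = ((φ (q m) : ℤ) : ℝ) := by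
    let g1 : L →ₗ[ℤ] ℝ := (g.restrictScalars ℤ) ∘ₗ L.subtype
    let g2 : L →ₗ[ℤ] ℝ := (Int.castAddHom ℝ).toIntLinearMap ∘ₗ φ ∘ₗ q
    have : g1 = g2 := b.ext fun i => by
      change g (b i : E) = ((φ (q (b i)) : ℤ) : ℝ)
      rw [← hBb, Basis.constr_basis]
    exact fun m => LinearMap.congr_fun this m
  refine ⟨g, fun m hm => ⟨_, hg ⟨m, hm⟩⟩, ⟨m0, m0.2, by rw [hg]; exact_mod_cast hφ⟩, ?_⟩
  intro z hz
  have hzK : (⟨z, hZ hz⟩ : L) ∈ K := Submodule.subset_span hz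
  have h1 : q ⟨z, hZ hz⟩ = 0 := by
    change T.mkQ (K.mkQ _) = 0
    rw [show K.mkQ ⟨z, hZ hz⟩ = 0 from (Submodule.Quotient.mk_eq_zero K).2 hzK, map_zero]
  rw [hg ⟨z, hZ hz⟩, h1]
  simp

/-! ### Facet description of the cone and heights of lattice points -/

section Facets

theorem ToricCone.mem_dualCone_iff_of_eq_hull (C : ToricCone L) {S : Set E}
    (hC : C.cone = PointedCone.hull ℝ S) (n : Dual ℝ E) :
    n ∈ C.dualCone ↔ ∀ s ∈ S, 0 ≤ n s := by
  rw [C.mem_dualCone]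
  constructor
  · intro h s hs
    exact h s (by rw [hC]; exact Submodule.subset_span hs)
  · intro h x hx
    rw [hC] at hx
    induction hx using Submodule.span_induction with
    | mem x hx => exact h x hx
    | zero => simp
    | add x y _ _ hx hy => rw [map_add]; exact add_nonneg hx hy
    | smul a x _ hx =>
      rw [← Nonneg.coe_smul, map_smul]
      exact mul_nonneg a.2 hx

theorem ToricCone.dual_ext (C : ToricCone L) {S : Set E} (hC : C.cone = PointedCone.hull ℝ S)
    {f g : Dual ℝ E} (h : ∀ s ∈ S, f s = g s) : f = g := by
  have h1 : ∀ x ∈ C.cone, f x = g x := by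
    intro x hx
    rw [hC] at hx
    induction hx using Submodule.span_induction with
    | mem x hx => exact h x hx
    | zero => simp
    | add x y _ _ hx hy => rw [map_add, map_add, hx, hy]
    | smul a x _ hx => rw [← Nonneg.coe_smul, map_smul, map_smul, hx]
  have h2 : ∀ x ∈ Submodule.span ℝ (C.cone : Set E), f x = g x := fun x hx => by
    induction hx using Submodule.span_induction with
    | mem x hx => exact h1 x hx
    | zero => simp
    | add x y _ _ hx hy => rw [map_add, map_add, hx, hy]
    | smul a x _ hx => rw [map_smul, map_smul, hx]
  exact LinearMap.ext fun x => h2 x (by rw [C.full_dim]; trivial)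

/-- The hypothesis `hext` makes the ray of `f` extremal. It also makes the ray rational: an integral
form vanishing on the generators killed by `f` must be a multiple of `f`. Scaling that form to take
the value one on the lattice makes it primitive. -/
theorem ToricCone.exists_normal_multiple [FiniteDimensional ℝ E] [DiscreteTopology L]
    [IsZLattice ℝ L] (C : ToricCone L) {S : Set E} (hSL : S ⊆ L)
    (hC : C.cone = PointedCone.hull ℝ S) {f : Dual ℝ E} (hf : f ∈ C.dualCone) (hf0 : f ≠ 0)
    (hext : ∀ g : Dual ℝ E, (∀ s ∈ S, f s = 0 → g s = 0) → ∃ c : ℝ, g = c • f) :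
    ∃ c : ℝ, 0 < c ∧ c • f ∈ C.normals := by
  obtain ⟨g, hgI, hg0, hgZ⟩ := exists_isIntegral_vanishing (L := L) {s | s ∈ S ∧ f s = 0}
    (fun s hs => hSL hs.1) f hf0 fun s hs => hs.2
  obtain ⟨c, rfl⟩ := hext g fun s hs h => hgZ s ⟨hs, h⟩
  have hc0 : c ≠ 0 := by
    rintro rfl
    obtain ⟨m, -, hm⟩ := hg0
    simp at hm
  -- The integral multiple may point the wrong way; the absolute value brings it back to the dual
  -- cone.
  have hI : IsIntegral L (|c| • f) := by
    rcases abs_choice c with h | h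
    · rwa [h]
    · intro m hm
      obtain ⟨z, hz⟩ := hgI m hm
      refine ⟨-z, ?_⟩
      rw [LinearMap.smul_apply, smul_eq_mul] at hz
      rw [h, LinearMap.smul_apply, smul_eq_mul, neg_mul, hz, Int.cast_neg]
  obtain ⟨h, hh, hI', m1, hm1, hm1'⟩ := hI.exists_primitive (by
    obtain ⟨m, hm, hm0⟩ := hg0
    refine ⟨m, hm, ?_⟩
    simp only [LinearMap.smul_apply, smul_eq_mul] at hm0 ⊢
    exact mul_ne_zero (abs_ne_zero.2 hc0) (right_ne_zero_of_mul hm0))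
  have hpos : 0 < h * |c| := mul_pos hh (abs_pos.2 hc0)
  rw [smul_smul] at hI' hm1'
  refine ⟨h * |c|, hpos, ?_, hI', ?_, ?_, ?_⟩
  · rw [C.mem_dualCone] at hf ⊢
    exact fun x hx => mul_nonneg hpos.le (hf x hx)
  · intro ε hε0 hε1 hε
    obtain ⟨z, hz⟩ := hε m1 hm1
    rw [LinearMap.smul_apply, hm1', smul_eq_mul, mul_one] at hz
    subst hz
    have h0 : 0 < z := by exact_mod_cast hε0
    have h1 : z < 1 := by exact_mod_cast hε1
    omega
  · rintro _ ⟨b, hb, rfl⟩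
    rw [SetLike.mem_coe, C.mem_dualCone] at *
    exact fun x hx => mul_nonneg hb (mul_nonneg hpos.le (hf x hx))
  · rintro x hx y hy z ⟨b, hb, rfl⟩ ⟨p, q, hp, hq, -, hpq⟩
    rw [SetLike.mem_coe, C.mem_dualCone_iff_of_eq_hull hC] at hx hy
    obtain ⟨d, rfl⟩ := hext x fun s hs h0 => by
      have h1 := LinearMap.congr_fun hpq s
      simp only [LinearMap.add_apply, LinearMap.smul_apply, smul_eq_mul, h0, mul_zero] at h1
      nlinarith [mul_nonneg hp.le (hx s hs), mul_nonneg hq.le (hy s hs)]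
    obtain ⟨s, hs, hfs⟩ : ∃ s ∈ S, f s ≠ 0 := by
      by_contra! h
      exact hf0 (C.dual_ext hC fun s hs => by simp [h s hs])
    have hfs' : 0 < f s := ((C.mem_dualCone_iff_of_eq_hull hC f).1 hf s hs).lt_of_ne' hfs
    have hd : 0 ≤ d := nonneg_of_mul_nonneg_left (hx s hs) hfs'
    refine ⟨d / (h * |c|), by positivity, ?_⟩
    rw [smul_smul, div_mul_cancel₀ _ hpos.ne']

/-- Among the forms of the dual cone that are negative at a point outside the cone, one that is
nonzero on the fewest generators spans an extremal ray. A positive multiple of it is therefore a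
facet normal that is negative there. -/
theorem ToricCone.mem_cone_iff [FiniteDimensional ℝ E] [DiscreteTopology L] [IsZLattice ℝ L]
    (C : ToricCone L) (x : E) : x ∈ C.cone ↔ ∀ n ∈ C.normals, 0 ≤ n x := by
  refine ⟨fun hx n hn => (C.mem_dualCone n).1 hn.1 x hx, fun hx => ?_⟩
  obtain ⟨S, hS, hSL, hC⟩ := C.rational
  by_contra hxC
  have hdual := C.mem_dualCone_iff_of_eq_hull hC
  obtain ⟨f0, hf0, hf0x⟩ : ∃ f ∈ C.dualCone, f x < 0 := by
    obtain ⟨f, hf, hfx⟩ := exists_dual_neg_of_notMem_hull hS.toFinset id x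
      (by simpa [← hC] using hxC)
    exact ⟨f, (hdual f).2 fun s hs => hf s (by simpa using hs), hfx⟩
  obtain ⟨f, ⟨hf, hfx⟩, hmin⟩ := (measure fun f : Dual ℝ E => {s | s ∈ S ∧ f s ≠ 0}.ncard).wf.has_min
    {f | f ∈ C.dualCone ∧ f x < 0} ⟨f0, hf0, hf0x⟩
  have hfS := (hdual f).1 hf
  have hfne : f ≠ 0 := by
    rintro rfl
    simp at hfx
  have hfin : {s | s ∈ S ∧ f s ≠ 0}.Finite := hS.subset fun s hs => hs.1
  have hne : {s | s ∈ S ∧ f s ≠ 0}.Nonempty := by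
    by_contra h
    rw [Set.not_nonempty_iff_eq_empty] at h
    refine hfne (C.dual_ext hC fun s hs => ?_)
    by_contra h0
    have : s ∈ {s | s ∈ S ∧ f s ≠ 0} := ⟨hs, h0⟩
    simp [h] at this
  have key : ∀ g : Dual ℝ E, (∀ s ∈ S, 0 ≤ g s) → (∀ s ∈ S, f s = 0 → g s = 0) →
      (∃ s ∈ S, f s ≠ 0 ∧ g s = 0) → 0 ≤ g x := by
    intro g hg hfg ⟨s, hs, hfs, hgs⟩
    by_contra! hgx
    refine hmin g ⟨(hdual g).2 hg, hgx⟩ (Set.ncard_lt_ncard ?_ hfin)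
    refine ⟨fun t ht => ⟨ht.1, fun h => ht.2 (hfg t ht.1 h)⟩, fun h => ?_⟩
    exact (h ⟨hs, hfs⟩).2 hgs
  -- Let `a` and `b` be the least and the greatest ratio `g s / f s`. Both `g - a • f` and `b • f -
  -- g` are in the dual cone and vanish on one more generator, so minimality makes them nonnegative
  -- at `x`. Adding gives `(b - a) * f x ≥ 0`, and `f x < 0` forces `a = b`.
  have hext : ∀ g : Dual ℝ E, (∀ s ∈ S, f s = 0 → g s = 0) → ∃ c : ℝ, g = c • f := by
    intro g hg
    obtain ⟨s0, ⟨hs0, hfs0⟩, h0⟩ := Set.exists_min_image _ (fun s => g s / f s) hfin hne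
    obtain ⟨s1, ⟨hs1, hfs1⟩, h1⟩ := Set.exists_max_image _ (fun s => g s / f s) hfin hne
    have hlow : ∀ s ∈ S, g s0 / f s0 * f s ≤ g s := by
      intro s hs
      by_cases h : f s = 0
      · simp [h, hg s hs h]
      · have := h0 s ⟨hs, h⟩
        rwa [le_div_iff₀ ((hfS s hs).lt_of_ne' h)] at this
    have hupp : ∀ s ∈ S, g s ≤ g s1 / f s1 * f s := by
      intro s hs
      by_cases h : f s = 0
      · simp [h, hg s hs h]
      · have := h1 s ⟨hs, h⟩
        rwa [div_le_iff₀ ((hfS s hs).lt_of_ne' h)] at this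
    have k0 : 0 ≤ (g - (g s0 / f s0) • f) x := key _
      (fun s hs => by have := hlow s hs; simp; linarith)
      (fun s hs h => by simp [h, hg s hs h])
      ⟨s0, hs0, hfs0, by simp [hfs0]⟩
    have k1 : 0 ≤ ((g s1 / f s1) • f - g) x := key _
      (fun s hs => by have := hupp s hs; simp; linarith)
      (fun s hs h => by simp [h, hg s hs h])
      ⟨s1, hs1, hfs1, by simp [hfs1]⟩
    simp only [LinearMap.sub_apply, LinearMap.smul_apply, smul_eq_mul] at k0 k1
    have hle := h0 s1 ⟨hs1, hfs1⟩
    have heq : g s0 / f s0 = g s1 / f s1 := by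
      by_contra hcon
      have := lt_of_le_of_ne hle hcon
      nlinarith
    exact ⟨g s0 / f s0, C.dual_ext hC fun s hs =>
      le_antisymm (by rw [heq]; exact hupp s hs) (hlow s hs)⟩
  obtain ⟨c, hc, hcn⟩ := C.exists_normal_multiple hSL hC hf hfne hext
  have := hx _ hcn
  simp only [LinearMap.smul_apply, smul_eq_mul] at this
  nlinarith

/-- Some positive multiple `h • n` is integral and takes the value one. Primitivity of `n` gives `1
≤ h`, and integrality of `n` gives `h ≤ 1`. -/
theorem ToricCone.exists_normal_eq_one [DiscreteTopology L] [IsZLattice ℝ L] (C : ToricCone L) {n : Dual ℝ E}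
    (hn : n ∈ C.normals) : ∃ m ∈ L, n m = 1 := by
  obtain ⟨-, hI, hP, -⟩ := hn
  have h0 : ∃ m ∈ L, n m ≠ 0 := by
    by_contra! h
    refine hP (1 / 2) (by norm_num) (by norm_num) fun m hm => ⟨0, ?_⟩
    simp [h m hm]
  obtain ⟨h, hh, hhI, m, hm, hm1⟩ := hI.exists_primitive h0
  obtain ⟨z, hz⟩ := hI m hm
  rw [LinearMap.smul_apply, hz, smul_eq_mul] at hm1
  rcases lt_or_ge h 1 with h1 | h1
  · exact absurd hhI (hP h hh h1)
  · refine ⟨m, hm, ?_⟩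
    have hz0 : (0 : ℝ) < z := pos_of_mul_pos_right (by rw [hm1]; exact one_pos) hh.le
    have hz1 : (1 : ℝ) ≤ z := by exact_mod_cast (show 0 < z by exact_mod_cast hz0)
    rw [hz]
    nlinarith

/-- If `n'` vanished on all generators killed by `n`, then `n - ε • n'` would stay in the dual cone
for small `ε`. Extremality would then put `n'` on the ray of `n`, and primitivity would make them
equal. -/
theorem ToricCone.exists_mem_generators (C : ToricCone L) {S : Set E} (hS : S.Finite)
    (hC : C.cone = PointedCone.hull ℝ S) {n n' : Dual ℝ E} (hn : n ∈ C.normals)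
    (hn' : n' ∈ C.normals) (hne : n' ≠ n) : ∃ s ∈ S, n s = 0 ∧ 0 < n' s := by
  obtain ⟨hn, hnI, hnP, hnE⟩ := hn
  obtain ⟨hn', hnI', hnP', -⟩ := hn'
  have hdual := C.mem_dualCone_iff_of_eq_hull hC
  by_contra! hcon
  refine hne ?_
  have key : ∃ ε : ℝ, 0 < ε ∧ ∀ s ∈ S, ε * n' s ≤ n s := by
    have h1 : ∀ᶠ ε : ℝ in nhdsWithin 0 (Set.Ioi 0), ∀ s ∈ S, ε * n' s ≤ n s := by
      rw [Filter.eventually_all_finite hS]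
      intro s hs
      rcases ((hdual n).1 hn s hs).eq_or_lt with h0 | h0
      · have := le_antisymm (hcon s hs h0.symm) ((hdual n').1 hn' s hs)
        simp [this, ← h0]
      · have hc : Filter.Tendsto (fun ε : ℝ => ε * n' s) (nhdsWithin 0 (Set.Ioi 0))
            (nhds (0 * n' s)) :=
          (tendsto_nhdsWithin_of_tendsto_nhds Filter.tendsto_id).mul_const _
        rw [zero_mul] at hc
        exact (hc.eventually_lt_const h0).mono fun _ h => h.le
    obtain ⟨ε, hε, h2⟩ := (h1.and self_mem_nhdsWithin).exists
    exact ⟨ε, h2, hε⟩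
  obtain ⟨ε, hε, hle⟩ := key
  have hx : (2 * ε) • n' ∈ (C.dualCone : Set (Dual ℝ E)) := by
    refine (hdual _).2 fun s hs => ?_
    have := (hdual n').1 hn' s hs
    simp only [LinearMap.smul_apply, smul_eq_mul]
    positivity
  have hy : (2 : ℝ) • (n - ε • n') ∈ (C.dualCone : Set (Dual ℝ E)) := by
    refine (hdual _).2 fun s hs => ?_
    have := hle s hs
    simp only [LinearMap.smul_apply, LinearMap.sub_apply, smul_eq_mul]
    linarith
  obtain ⟨c, hc, hcn⟩ := hnE.left_mem_of_mem_openSegment hx hy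
    (z := n) ⟨1, zero_le_one, (one_smul _ _).symm⟩
    ⟨1 / 2, 1 / 2, by norm_num, by norm_num, by norm_num, by
      ext s
      simp only [LinearMap.smul_apply, LinearMap.add_apply, LinearMap.sub_apply, smul_eq_mul]
      ring⟩
  have hn'c : n' = (c / (2 * ε)) • n := by
    rw [div_eq_inv_mul, mul_smul, ← hcn, smul_smul, inv_mul_cancel₀ (by positivity), one_smul]
  set a := c / (2 * ε) with ha
  have ha0 : 0 ≤ a := by positivity
  rcases ha0.eq_or_lt with h0 | h0
  · exfalso
    refine hnP' (1 / 2) (by norm_num) (by norm_num) fun m _ => ⟨0, ?_⟩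
    simp [hn'c, ← h0]
  rcases lt_trichotomy a 1 with h1 | h1 | h1
  · exact absurd (hn'c ▸ hnI') (hnP a h0 h1)
  · rw [hn'c, h1, one_smul]
  · refine absurd ?_ (hnP' a⁻¹ (by positivity) (inv_lt_one_of_one_lt₀ h1))
    rwa [hn'c, smul_smul, inv_mul_cancel₀ h0.ne', one_smul]

instance (C : ToricCone L) : Fintype C.normals := Fintype.ofFinite _

/-- A facet has a lattice point in its relative interior. -/
theorem ToricCone.exists_facet_point (C : ToricCone L) (n : C.normals) :
    ∃ m ∈ L, (n : Dual ℝ E) m = 0 ∧ ∀ n' : C.normals, n' ≠ n → 0 < (n' : Dual ℝ E) m := by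
  classical
  obtain ⟨S, hS, hSL, hC⟩ := C.rational
  have h : ∀ n' : C.normals, ∃ s ∈ L, s ∈ C.cone ∧ (n : Dual ℝ E) s = 0 ∧
      (n' ≠ n → 0 < (n' : Dual ℝ E) s) := by
    intro n'
    by_cases hne : n' = n
    · exact ⟨0, L.zero_mem, C.cone.zero_mem, by simp, fun h => absurd hne h⟩
    · obtain ⟨s, hs, h0, h1⟩ := C.exists_mem_generators hS hC n.2 n'.2 (Subtype.coe_injective.ne hne)
      exact ⟨s, hSL hs, by rw [hC]; exact Submodule.subset_span hs, h0, fun _ => h1⟩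
  choose s hsL hsC hs0 hs1 using h
  refine ⟨∑ n', s n', L.sum_mem fun n' _ => hsL n', by simp [hs0], fun n' hne => ?_⟩
  rw [map_sum]
  exact Finset.sum_pos' (fun i _ => (C.mem_dualCone _).1 n'.2.1 _ (hsC i))
    ⟨n', Finset.mem_univ _, hs1 n' hne⟩

/-- The cone has a lattice point in its interior. -/
theorem ToricCone.exists_interior_point [DiscreteTopology L] [IsZLattice ℝ L] (C : ToricCone L) :
    ∃ m ∈ L, ∀ n : C.normals, 0 < (n : Dual ℝ E) m := by
  obtain ⟨S, hS, hSL, hC⟩ := C.rational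
  refine ⟨∑ s ∈ hS.toFinset, s, L.sum_mem fun s hs => hSL (by simpa using hs), fun n => ?_⟩
  have hn := (C.mem_dualCone_iff_of_eq_hull hC _).1 n.2.1
  rw [map_sum]
  refine Finset.sum_pos' (fun s hs => hn s (by simpa using hs)) ?_
  by_contra! h
  obtain ⟨m, -, hm⟩ := C.exists_normal_eq_one n.2
  have : (n : Dual ℝ E) = 0 := C.dual_ext hC fun s hs =>
    le_antisymm (h s (by simpa using hs)) (hn s hs)
  simp [this] at hm

theorem ToricCone.mem_interior_iff [FiniteDimensional ℝ E] [DiscreteTopology L] [IsZLattice ℝ L]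
    (C : ToricCone L) (x : E) :
    x ∈ interior (C.cone : Set E) ↔ ∀ n : C.normals, 0 < (n : Dual ℝ E) x := by
  constructor
  · intro hx n
    -- From an interior point a small step against `m` stays in the cone, yet lowers every normal;
    -- hence all values were positive.
    obtain ⟨m, -, hm⟩ := C.exists_interior_point
    have hc : Filter.Tendsto (fun ε : ℝ => x - ε • m) (nhdsWithin 0 (Set.Ioi 0))
        (nhds (x - (0 : ℝ) • m)) :=
      tendsto_nhdsWithin_of_tendsto_nhds (Continuous.tendsto (by fun_prop) 0)
    rw [zero_smul, sub_zero] at hc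
    obtain ⟨ε, h1, h2⟩ := ((hc.eventually (isOpen_interior.mem_nhds hx)).and
      self_mem_nhdsWithin).exists
    have h3 := (C.mem_cone_iff _).1 (interior_subset h1) n n.2
    rw [map_sub, map_smul, smul_eq_mul] at h3
    have := mul_pos (show 0 < ε from h2) (hm n)
    linarith
  · intro hx
    have hopen : IsOpen {y : E | ∀ n : C.normals, 0 < (n : Dual ℝ E) y} := by
      simp only [Set.ofPred_forall]
      exact isOpen_iInter_of_finite fun n =>
        isOpen_lt continuous_const (LinearMap.continuous_of_finiteDimensional _)
    refine interior_maximal (fun y hy => ?_) hopen hx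
    exact (C.mem_cone_iff y).2 fun n hn => (hy ⟨n, hn⟩).le

/-- Here pointedness enters; it makes the degree of an isomorphism of conic modules unique. -/
theorem ToricCone.eq_zero_of_normals [FiniteDimensional ℝ E] [DiscreteTopology L]
    [IsZLattice ℝ L] (C : ToricCone L) {x : E} (hx : ∀ n : C.normals, (n : Dual ℝ E) x = 0) :
    x = 0 :=
  C.pointed x ((C.mem_cone_iff x).2 fun n hn => (hx ⟨n, hn⟩).ge)
    ((C.mem_cone_iff _).2 fun n hn => by rw [map_neg, hx ⟨n, hn⟩, neg_zero])

/-- The value of a facet normal on a lattice point. -/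
def ToricCone.height (C : ToricCone L) (n : C.normals) (m : L) : ℤ := ⌊(n : Dual ℝ E) m⌋

theorem ToricCone.coe_height (C : ToricCone L) (n : C.normals) (m : L) :
    (C.height n m : ℝ) = (n : Dual ℝ E) m := by
  obtain ⟨z, hz⟩ := n.2.2.1 m m.2
  rw [ToricCone.height, hz, Int.floor_intCast]

theorem ToricCone.height_add (C : ToricCone L) (n : C.normals) (a b : L) :
    C.height n (a + b) = C.height n a + C.height n b := by
  have : ((C.height n (a + b) : ℤ) : ℝ) = ((C.height n a + C.height n b : ℤ) : ℝ) := by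
    push_cast
    simp only [C.coe_height, Submodule.coe_add, map_add]
  exact_mod_cast this

theorem ToricCone.height_sub (C : ToricCone L) (n : C.normals) (a b : L) :
    C.height n (a - b) = C.height n a - C.height n b := by
  have := C.height_add n (a - b) b
  rw [sub_add_cancel] at this
  omega

theorem ToricCone.height_zero (C : ToricCone L) (n : C.normals) : C.height n 0 = 0 := by
  have := C.height_add n 0 0
  rw [add_zero] at this
  omega

/-- There are lattice points with prescribed height over one facet and large heights over all
others. -/
theorem ToricCone.exists_height_eq [DiscreteTopology L] [IsZLattice ℝ L] (C : ToricCone L) (n : C.normals)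
    (b : C.normals → ℤ) :
    ∃ m : L, C.height n m = b n ∧ ∀ n', b n' ≤ C.height n' m := by
  obtain ⟨p, hpL, hp⟩ := C.exists_normal_eq_one n.2
  obtain ⟨q, hqL, hq0, hq⟩ := C.exists_facet_point n
  have hp' : C.height n ⟨p, hpL⟩ = 1 := by
    have := C.coe_height n ⟨p, hpL⟩
    rw [show ((⟨p, hpL⟩ : L) : E) = p from rfl, hp] at this
    exact_mod_cast this
  have hq0' : C.height n ⟨q, hqL⟩ = 0 := by
    have := C.coe_height n ⟨q, hqL⟩
    rw [show ((⟨q, hqL⟩ : L) : E) = q from rfl, hq0] at this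
    exact_mod_cast this
  have hq' : ∀ n', n' ≠ n → 0 < C.height n' ⟨q, hqL⟩ := by
    intro n' hne
    have := hq n' hne
    have h2 := C.coe_height n' ⟨q, hqL⟩
    rw [show ((⟨q, hqL⟩ : L) : E) = q from rfl] at h2
    rw [← h2] at this
    exact_mod_cast this
  have hsmul : ∀ (z : ℤ) (n' : C.normals) (m : L), C.height n' (z • m) = z * C.height n' m := by
    intro z n' m
    have : ((C.height n' (z • m) : ℤ) : ℝ) = ((z * C.height n' m : ℤ) : ℝ) := by
      push_cast
      simp [C.coe_height]
    exact_mod_cast this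
  -- The facet point `q` has height at least one over every other facet and zero over `n`, so `N`
  -- copies of it make up every deficit without changing the height over `n`.
  let N : ℤ := ∑ n', |b n' - b n * C.height n' ⟨p, hpL⟩|
  refine ⟨b n • ⟨p, hpL⟩ + N • ⟨q, hqL⟩, ?_, fun n' => ?_⟩
  · rw [C.height_add, hsmul, hsmul, hp', hq0']
    ring
  · by_cases hne : n' = n
    · subst hne
      rw [C.height_add, hsmul, hsmul, hp', hq0']
      simp
    · rw [C.height_add, hsmul, hsmul]
      have h1 := hq' n' hne
      have h2 : |b n' - b n * C.height n' ⟨p, hpL⟩| ≤ N :=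
        Finset.single_le_sum (f := fun n' => |b n' - b n * C.height n' ⟨p, hpL⟩|)
          (fun i _ => abs_nonneg _) (Finset.mem_univ n')
      have h3 := le_abs_self (b n' - b n * C.height n' ⟨p, hpL⟩)
      nlinarith [abs_nonneg (b n' - b n * C.height n' ⟨p, hpL⟩)]

/-- There are lattice points with large heights over all facets. -/
theorem ToricCone.exists_le_height [DiscreteTopology L] [IsZLattice ℝ L] (C : ToricCone L) (b : C.normals → ℤ) :
    ∃ m : L, ∀ n, b n ≤ C.height n m := by
  by_cases h : Nonempty C.normals
  · obtain ⟨n⟩ := h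
    exact (C.exists_height_eq n b).imp fun _ h => h.2
  · exact ⟨0, fun n => absurd ⟨n⟩ h⟩

end Facets

/-! ### Geometry of the cells of a chamber -/

section Cells

open Filter Topology

variable {C : ToricCone L} {v : E}

/-- Strict inequalities survive a small step, and an equality `n x = d_n` becomes strict when `n`
decreases along `t`. This is how new points and cells are produced from known ones. -/
theorem eventually_add_smul_mem_cellSet {Ω Ω' : Set C.normals} (hΩ : Ω ⊆ Ω') {x t : E}
    (hx : x ∈ cellSet C v Ω) (hneg : ∀ n ∈ Ω', n ∉ Ω → (n : Dual ℝ E) t < 0)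
    (hzero : ∀ n ∉ Ω', (n : Dual ℝ E) t = 0) :
    ∀ᶠ ε : ℝ in 𝓝[>] 0, x + ε • t ∈ cellSet C v Ω' := by
  have hlim : ∀ n : Dual ℝ E, Tendsto (fun ε : ℝ => n (x + ε • t)) (𝓝[>] 0) (𝓝 (n x)) := by
    intro n
    have h : Tendsto (fun ε : ℝ => n x + ε * n t) (𝓝 0) (𝓝 (n x + 0 * n t)) :=
      (Continuous.tendsto (by fun_prop) 0)
    simpa using tendsto_nhdsWithin_of_tendsto_nhds h
  have h : ∀ n : C.normals, ∀ᶠ ε : ℝ in 𝓝[>] 0,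
      (n ∈ Ω' → (⌈(n : Dual ℝ E) v⌉ : ℝ) - 1 < (n : Dual ℝ E) (x + ε • t) ∧
        (n : Dual ℝ E) (x + ε • t) < (⌈(n : Dual ℝ E) v⌉ : ℝ)) ∧
      (n ∉ Ω' → (n : Dual ℝ E) (x + ε • t) = (⌈(n : Dual ℝ E) v⌉ : ℝ)) := by
    intro n
    by_cases h' : n ∈ Ω'
    · by_cases h : n ∈ Ω
      · have h1 := hx.1 n h
        filter_upwards [(hlim n).eventually_const_lt h1.1, (hlim n).eventually_lt_const h1.2]
          with ε ha hb
        exact ⟨fun _ => ⟨ha, hb⟩, fun hn => absurd h' hn⟩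
      · have h1 := hx.2 n h
        filter_upwards [(hlim n).eventually_const_lt (by rw [h1]; exact sub_one_lt _),
          self_mem_nhdsWithin] with ε ha hε
        refine ⟨fun _ => ⟨ha, ?_⟩, fun hn => absurd h' hn⟩
        rw [map_add, map_smul, h1, smul_eq_mul]
        have := mul_neg_of_pos_of_neg (show 0 < ε from hε) (hneg n h' h)
        linarith
    · refine Eventually.of_forall fun ε => ⟨fun hn => absurd hn h', fun _ => ?_⟩
      rw [map_add, map_smul, hzero n h', hx.2 n fun hn => h' (hΩ hn)]
      simp
  filter_upwards [eventually_all.2 h] with ε hε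
  exact ⟨fun n hn => (hε n).1 hn, fun n hn => (hε n).2 hn⟩

namespace Cell

theorem eq_of_Ω_eq {τ τ' : Cell C v} (h : τ.Ω = τ'.Ω) : τ = τ' := by
  cases τ
  cases τ'
  simp_all

theorem point_mem (τ : Cell C v) : τ.point ∈ cellSet C v τ.Ω := τ.nonempty.some_mem

/-- A cell is relatively open in the affine space cut out by its equalities, so every direction
killed by the normals outside `Ω` is, up to scale, a difference of two of its points. -/
theorem mem_dir {τ : Cell C v} {t : E} :
    t ∈ τ.dir ↔ ∀ n ∉ τ.Ω, (n : Dual ℝ E) t = 0 := by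
  constructor
  · intro ht n hn
    have hle : τ.dir ≤ LinearMap.ker (n : Dual ℝ E) := by
      refine Submodule.span_le.2 ?_
      rintro _ ⟨x, hx, y, hy, rfl⟩
      simp [hx.2 n hn, hy.2 n hn]
    exact hle ht
  · intro ht
    obtain ⟨ε, h1, h2⟩ := ((eventually_add_smul_mem_cellSet subset_rfl τ.point_mem
      (fun n hn hn' => absurd hn hn') ht).and self_mem_nhdsWithin).exists
    have h3 : ε • t ∈ τ.dir := by
      have := vsub_mem_vectorSpan ℝ (s := τ.carrier) h1 τ.point_mem
      rwa [vsub_eq_sub, add_sub_cancel_left] at this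
    exact (Submodule.smul_mem_iff _ (ne_of_gt h2)).1 h3

theorem dir_mono {τ' τ : Cell C v} (h : τ'.Ω ⊆ τ.Ω) : τ'.dir ≤ τ.dir := fun _ ht =>
  mem_dir.2 fun n hn => mem_dir.1 ht n fun hn' => hn (h hn')

theorem sub_mem_dir {τ' τ : Cell C v} (h : τ'.Ω ⊆ τ.Ω) {x' x : E} (hx' : x' ∈ cellSet C v τ'.Ω)
    (hx : x ∈ cellSet C v τ.Ω) : x' - x ∈ τ.dir :=
  mem_dir.2 fun n hn => by
    rw [map_sub, hx.2 n hn, hx'.2 n fun hn' => hn (h hn'), sub_self]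

theorem sub_notMem_dir {τ' τ : Cell C v} (h : τ'.Ω ⊆ τ.Ω) (hne : τ'.Ω ≠ τ.Ω) {x' x : E}
    (hx' : x' ∈ cellSet C v τ'.Ω) (hx : x ∈ cellSet C v τ.Ω) : x' - x ∉ τ'.dir := by
  obtain ⟨n, hn, hn'⟩ := Set.exists_of_ssubset (h.ssubset_of_ne hne)
  intro hmem
  have h1 := mem_dir.1 hmem n hn'
  rw [map_sub, hx'.2 n hn'] at h1
  linarith [(hx.1 n hn).2]

theorem dir_lt {τ' τ : Cell C v} (h : τ'.Ω ⊆ τ.Ω) (hne : τ'.Ω ≠ τ.Ω) : τ'.dir < τ.dir :=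
  SetLike.lt_iff_le_and_exists.2 ⟨dir_mono h, _, sub_mem_dir h τ'.point_mem τ.point_mem,
    sub_notMem_dir h hne τ'.point_mem τ.point_mem⟩

variable [FiniteDimensional ℝ E]

theorem codim_add_finrank (τ : Cell C v) : τ.codim + finrank ℝ τ.dir = finrank ℝ E :=
  Nat.sub_add_cancel (Submodule.finrank_le _)

theorem finrank_lt {τ' τ : Cell C v} (h : τ'.Ω ⊆ τ.Ω) (hne : τ'.Ω ≠ τ.Ω) :
    finrank ℝ τ'.dir < finrank ℝ τ.dir :=
  Submodule.finrank_lt_finrank_of_lt (dir_lt h hne)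

/-- Between two incident cells whose dimensions differ by two there are exactly two cells. -/
theorem exists_diamond {τ'' τ : Cell C v} (hΩ : τ''.Ω ⊆ τ.Ω) (hcodim : τ''.codim = τ.codim + 2) :
    ∃ τ₁ τ₂ : Cell C v, τ₁ ≠ τ₂ ∧ τ''.Ω ⊆ τ₁.Ω ∧ τ₁.Ω ⊆ τ.Ω ∧ τ''.Ω ⊆ τ₂.Ω ∧ τ₂.Ω ⊆ τ.Ω ∧
      τ₁.codim = τ.codim + 1 ∧ τ₂.codim = τ.codim + 1 ∧ τ.Ω ⊆ τ₁.Ω ∪ τ₂.Ω ∧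
      ∀ τ' : Cell C v, τ''.Ω ⊆ τ'.Ω → τ'.Ω ⊆ τ.Ω → τ'.codim = τ.codim + 1 →
        τ' = τ₁ ∨ τ' = τ₂ := by
  have hdim : finrank ℝ τ.dir = finrank ℝ τ''.dir + 2 := by
    have := τ.codim_add_finrank
    have := τ''.codim_add_finrank
    omega
  have hne : τ''.Ω ≠ τ.Ω := fun h => by
    rw [eq_of_Ω_eq h] at hdim
    omega
  set x := τ.point
  set x'' := τ''.point
  have hx : x ∈ cellSet C v τ.Ω := τ.point_mem
  have hx'' : x'' ∈ cellSet C v τ''.Ω := τ''.point_mem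
  -- Modulo the direction of `τ''`, the direction of `τ` is a plane, spanned by `t₀` and a vector
  -- `p` chosen below. All normals in `τ.Ω \ τ''.Ω` are positive on `t₀`, so in this plane they are
  -- ordered by their slopes `q n = n p / n t₀`; the steepest and the flattest bound the sector of
  -- `τ`.
  set t₀ := x'' - x with ht₀
  have ht₀D : t₀ ∈ τ.dir := sub_mem_dir hΩ hx'' hx
  have hpos : ∀ n ∈ τ.Ω \ τ''.Ω, 0 < (n : Dual ℝ E) t₀ := by
    rintro n ⟨hn, hn'⟩
    rw [ht₀, map_sub, hx''.2 n hn']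
    linarith [(hx.1 n hn).2]
  let W := τ''.dir ⊔ Submodule.span ℝ {t₀}
  have hW : finrank ℝ W < finrank ℝ τ.dir := by
    have h1 := Submodule.finrank_add_le_finrank_add_finrank τ''.dir (Submodule.span ℝ {t₀})
    have h2 := finrank_span_le_card (R := ℝ) ({t₀} : Set E)
    simp only [Set.toFinset_singleton, Finset.card_singleton] at h2
    change finrank ℝ W ≤ _ at h1
    omega
  have hWle : W ≤ τ.dir := sup_le (dir_mono hΩ) (by simpa using ht₀D)
  obtain ⟨p, hpD, hpW⟩ := SetLike.exists_of_lt
    (lt_of_le_of_ne hWle fun h => by rw [h] at hW; omega)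
  have hspan : ∀ t ∈ τ.dir, ∃ t'' ∈ τ''.dir, ∃ a s : ℝ, t = t'' + a • t₀ + s • p := by
    have hle : W ⊔ Submodule.span ℝ {p} ≤ τ.dir := sup_le hWle (by simpa using hpD)
    have hlt : W < W ⊔ Submodule.span ℝ {p} := SetLike.lt_iff_le_and_exists.2
      ⟨le_sup_left, p, Submodule.mem_sup_right (Submodule.mem_span_singleton_self p), hpW⟩
    have hlt' : τ''.dir < W := SetLike.lt_iff_le_and_exists.2
      ⟨le_sup_left, t₀, Submodule.mem_sup_right (Submodule.mem_span_singleton_self _),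
        sub_notMem_dir hΩ hne hx'' hx⟩
    have h1 := Submodule.finrank_lt_finrank_of_lt hlt
    have h2 := Submodule.finrank_lt_finrank_of_lt hlt'
    have heq := Submodule.eq_of_le_of_finrank_le hle (by omega)
    intro t ht
    rw [← heq] at ht
    obtain ⟨y, hy, z, hz, rfl⟩ := Submodule.mem_sup.1 ht
    obtain ⟨y'', hy'', z', hz', rfl⟩ := Submodule.mem_sup.1 hy
    obtain ⟨a, rfl⟩ := Submodule.mem_span_singleton.1 hz'
    obtain ⟨s, rfl⟩ := Submodule.mem_span_singleton.1 hz
    exact ⟨y'', hy'', a, s, rfl⟩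
  let q : C.normals → ℝ := fun n => (n : Dual ℝ E) p / (n : Dual ℝ E) t₀
  have hq : ∀ n ∈ τ.Ω \ τ''.Ω, (n : Dual ℝ E) p = q n * (n : Dual ℝ E) t₀ := fun n hn =>
    (div_mul_cancel₀ _ (hpos n hn).ne').symm
  have hInon : (τ.Ω \ τ''.Ω).Nonempty :=
    (Set.exists_of_ssubset (hΩ.ssubset_of_ne hne)).imp fun n h => ⟨h.1, h.2⟩
  obtain ⟨n₁, hn₁, hmax⟩ := Set.exists_max_image (τ.Ω \ τ''.Ω) q (Set.toFinite _) hInon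
  obtain ⟨n₂, hn₂, hmin⟩ := Set.exists_min_image (τ.Ω \ τ''.Ω) q (Set.toFinite _) hInon
  have hlt : q n₂ < q n₁ := by
    refine lt_of_le_of_ne (hmin n₁ hn₁) fun heq => hpW ?_
    have hu : p - q n₁ • t₀ ∈ τ''.dir := by
      refine mem_dir.2 fun n hn => ?_
      by_cases hnΩ : n ∈ τ.Ω
      · have : q n = q n₁ :=
          le_antisymm (hmax n ⟨hnΩ, hn⟩) (heq ▸ hmin n ⟨hnΩ, hn⟩)
        rw [map_sub, map_smul, hq n ⟨hnΩ, hn⟩, this, smul_eq_mul, sub_self]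
      · rw [map_sub, map_smul, mem_dir.1 hpD n hnΩ, mem_dir.1 ht₀D n hnΩ]
        simp
    have := W.add_mem (Submodule.mem_sup_left hu)
      (Submodule.mem_sup_right (Submodule.smul_mem _ (q n₁) (Submodule.mem_span_singleton_self t₀)))
    simpa using this
  -- Moving from `x''` along `s • p - a • t₀` changes `n` at the rate `(s * q n - a) * n t₀`. If
  -- this is never positive, the move enters a cell that stays on the facets where the rate is zero.
  -- The pairs `(max q, 1)` and `(-min q, -1)` for `(a, s)` give the two sides of the sector.
  have hcell : ∀ a s : ℝ, (∀ n ∈ τ.Ω \ τ''.Ω, s * q n ≤ a) →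
      (cellSet C v (τ''.Ω ∪ {n | n ∈ τ.Ω \ τ''.Ω ∧ s * q n ≠ a})).Nonempty := by
    intro a s ha
    refine (eventually_add_smul_mem_cellSet Set.subset_union_left (t := s • p - a • t₀) hx''
      ?_ ?_).exists.imp' (fun ε => x'' + ε • (s • p - a • t₀)) fun _ h => h
    · rintro n (hn | ⟨hn, hna⟩) hn'
      · exact absurd hn hn'
      · rw [map_sub, map_smul, map_smul, hq n hn, smul_eq_mul, smul_eq_mul]
        nlinarith [hpos n hn, lt_of_le_of_ne (ha n hn) hna]
    · intro n hn
      have hn'' : n ∉ τ''.Ω := fun h => hn (Or.inl h)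
      by_cases hnΩ : n ∈ τ.Ω
      · have : s * q n = a := by
          by_contra h
          exact hn (Or.inr ⟨⟨hnΩ, hn''⟩, h⟩)
        rw [map_sub, map_smul, map_smul, hq n ⟨hnΩ, hn''⟩, smul_eq_mul, smul_eq_mul, ← this]
        ring
      · rw [map_sub, map_smul, map_smul, mem_dir.1 hpD n hnΩ, mem_dir.1 ht₀D n hnΩ]
        simp
  let τ₁ : Cell C v := ⟨_, hcell (q n₁) 1 fun n hn => by simpa using hmax n hn⟩
  let τ₂ : Cell C v := ⟨_, hcell (-q n₂) (-1) fun n hn => by simpa using hmin n hn⟩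
  have hτ₁ : τ₁.Ω = τ''.Ω ∪ {n | n ∈ τ.Ω \ τ''.Ω ∧ q n ≠ q n₁} := by simp [τ₁]
  have hτ₂ : τ₂.Ω = τ''.Ω ∪ {n | n ∈ τ.Ω \ τ''.Ω ∧ q n ≠ q n₂} := by simp [τ₂, neg_inj]
  have hle₁ : τ''.Ω ⊆ τ₁.Ω := by rw [hτ₁]; exact Set.subset_union_left
  have hle₂ : τ''.Ω ⊆ τ₂.Ω := by rw [hτ₂]; exact Set.subset_union_left
  have hle₁' : τ₁.Ω ⊆ τ.Ω := by rw [hτ₁]; exact Set.union_subset hΩ fun n hn => hn.1.1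
  have hle₂' : τ₂.Ω ⊆ τ.Ω := by rw [hτ₂]; exact Set.union_subset hΩ fun n hn => hn.1.1
  have h21 : n₂ ∈ τ₁.Ω := by rw [hτ₁]; exact Or.inr ⟨hn₂, hlt.ne⟩
  have h12 : n₁ ∈ τ₂.Ω := by rw [hτ₂]; exact Or.inr ⟨hn₁, hlt.ne'⟩
  have h11 : n₁ ∉ τ₁.Ω := by
    rw [hτ₁]
    rintro (h | h)
    exacts [hn₁.2 h, h.2 rfl]
  have h22 : n₂ ∉ τ₂.Ω := by
    rw [hτ₂]
    rintro (h | h)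
    exacts [hn₂.2 h, h.2 rfl]
  have hmid : ∀ τ' : Cell C v, τ''.Ω ⊆ τ'.Ω → τ'.Ω ⊆ τ.Ω → τ''.Ω ≠ τ'.Ω → τ'.Ω ≠ τ.Ω →
      τ'.codim = τ.codim + 1 := by
    intro τ' h1 h2 h3 h4
    have := finrank_lt h1 h3
    have := finrank_lt h2 h4
    have := τ'.codim_add_finrank
    have := τ.codim_add_finrank
    omega
  refine ⟨τ₁, τ₂, fun h => h11 (h ▸ h12), hle₁, hle₁', hle₂, hle₂',
    hmid τ₁ hle₁ hle₁' (fun h => hn₂.2 (h ▸ h21)) (fun h => h11 (h ▸ hn₁.1)),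
    hmid τ₂ hle₂ hle₂' (fun h => hn₁.2 (h ▸ h12)) (fun h => h22 (h ▸ hn₂.1)), ?_, ?_⟩
  · intro n hn
    by_cases hn'' : n ∈ τ''.Ω
    · exact Or.inl (hle₁ hn'')
    · by_cases h : q n = q n₁
      · exact Or.inr (by rw [hτ₂]; exact Or.inr ⟨⟨hn, hn''⟩, by rw [h]; exact hlt.ne'⟩)
      · exact Or.inl (by rw [hτ₁]; exact Or.inr ⟨⟨hn, hn''⟩, h⟩)
  · intro τ' h1 h2 h3
    have hne1 : τ''.Ω ≠ τ'.Ω := fun h => by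
      have := eq_of_Ω_eq h
      subst this
      omega
    have hne2 : τ'.Ω ≠ τ.Ω := fun h => by
      have := eq_of_Ω_eq h
      subst this
      omega
    obtain ⟨x', hx'⟩ := τ'.nonempty
    -- For a cell in between, `a + s * q n` is nonnegative, and it is zero exactly for the normals
    -- outside `τ'.Ω`. Such a normal therefore has extreme slope, maximal or minimal according to
    -- the sign of `s`.
    obtain ⟨t'', ht'', a, s, ht⟩ := hspan (x'' - x')
      (dir_mono h2 (sub_mem_dir h1 hx'' hx'))
    have hval : ∀ n ∈ τ.Ω \ τ''.Ω,
        (n : Dual ℝ E) (x'' - x') = (a + s * q n) * (n : Dual ℝ E) t₀ := by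
      intro n hn
      rw [ht, map_add, map_add, map_smul, map_smul, mem_dir.1 ht'' n hn.2, hq n hn,
        smul_eq_mul, smul_eq_mul]
      ring
    have hin : ∀ n ∈ τ.Ω \ τ''.Ω, n ∈ τ'.Ω → 0 < a + s * q n := by
      intro n hn hn'
      have h4 := hval n hn
      rw [map_sub, hx''.2 n hn.2] at h4
      have := (hx'.1 n hn').2
      exact pos_of_mul_pos_left (by linarith) (hpos n hn).le
    have hout : ∀ n ∈ τ.Ω \ τ''.Ω, n ∉ τ'.Ω → a + s * q n = 0 := by
      intro n hn hn'
      have h4 := hval n hn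
      rw [map_sub, hx''.2 n hn.2, hx'.2 n hn', sub_self, eq_comm, mul_eq_zero] at h4
      exact h4.resolve_right (hpos n hn).ne'
    have hall : ∀ n ∈ τ.Ω \ τ''.Ω, 0 ≤ a + s * q n := fun n hn => by
      by_cases h : n ∈ τ'.Ω
      exacts [(hin n hn h).le, (hout n hn h).ge]
    obtain ⟨m, hm, hm'⟩ := Set.exists_of_ssubset (h2.ssubset_of_ne hne2)
    obtain ⟨l, hl, hl'⟩ := Set.exists_of_ssubset (h1.ssubset_of_ne hne1)
    have hmI : m ∈ τ.Ω \ τ''.Ω := ⟨hm, fun h => hm' (h1 h)⟩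
    have hlI : l ∈ τ.Ω \ τ''.Ω := ⟨h2 hl, hl'⟩
    have hm0 := hout m hmI hm'
    have hl0 := hin l hlI hl
    have hext : ∀ n₀ ∈ τ.Ω \ τ''.Ω, s ≠ 0 → q m = q n₀ →
        τ'.Ω = τ''.Ω ∪ {n | n ∈ τ.Ω \ τ''.Ω ∧ q n ≠ q n₀} := by
      intro n₀ _ hs hmn
      ext n
      constructor
      · intro hn
        by_cases hn'' : n ∈ τ''.Ω
        · exact Or.inl hn''
        · refine Or.inr ⟨⟨h2 hn, hn''⟩, fun h => ?_⟩
          have := hin n ⟨h2 hn, hn''⟩ hn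
          rw [h, ← hmn, hm0] at this
          exact this.false
      · rintro (hn | ⟨hn, hne⟩)
        · exact h1 hn
        · by_contra hn'
          have := hout n hn hn'
          rw [← hm0, add_right_inj] at this
          exact hne ((mul_left_cancel₀ hs this).trans hmn)
    have hs : s ≠ 0 := by
      rintro rfl
      simp only [zero_mul, add_zero] at hm0 hl0
      linarith
    rcases hs.lt_or_gt with hs' | hs'
    · refine Or.inl (eq_of_Ω_eq ?_)
      rw [hτ₁]
      refine hext n₁ hn₁ hs (le_antisymm (hmax m hmI) ?_)
      have := hall n₁ hn₁
      nlinarith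
    · refine Or.inr (eq_of_Ω_eq ?_)
      rw [hτ₂]
      refine hext n₂ hn₂ hs (le_antisymm ?_ (hmin m hmI))
      have := hall n₂ hn₂
      nlinarith

end Cell

end Cells

/-! ### Volume forms and the signs of a diamond -/

section Orientations

variable {C : ToricCone L} {v : E}

/-- The sequence `u, b 0, b 1, …`. -/
def consSeq (u : E) (b : ℕ → E) : ℕ → E
  | 0 => u
  | j + 1 => b j

namespace Cell

/-- With a retraction onto the direction, volume forms of different cells can be evaluated on the
same sequence of vectors of `E`, without transport between subspaces or index types. -/
theorem exists_dirProj (τ : Cell C v) : ∃ P : E →ₗ[ℝ] τ.dir, P ∘ₗ τ.dir.subtype = LinearMap.id :=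
  τ.dir.subtype.exists_leftInverse_of_injective τ.dir.ker_subtype

/-- A linear projection to the direction of a cell. -/
def dirProj (τ : Cell C v) : E →ₗ[ℝ] τ.dir := τ.exists_dirProj.choose

theorem dirProj_apply (τ : Cell C v) {t : E} (ht : t ∈ τ.dir) : τ.dirProj t = ⟨t, ht⟩ :=
  LinearMap.congr_fun τ.exists_dirProj.choose_spec ⟨t, ht⟩

/-- A volume form representing the orientation of a cell, on the leading terms of a sequence. -/
def vol (o : CellOrientations C v) (τ : Cell C v) (w : ℕ → E) : ℝ :=
  (o τ).someVector fun j => τ.dirProj (w j)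

theorem vol_neg (o : CellOrientations C v) (τ : Cell C v) (h : 0 < finrank ℝ τ.dir) (u : E)
    (b : ℕ → E) : τ.vol o (consSeq (-u) b) = -τ.vol o (consSeq u b) := by
  have hupd : ∀ u : E, (fun j : Fin (finrank ℝ τ.dir) => τ.dirProj (consSeq u b j)) =
      Function.update (fun j : Fin (finrank ℝ τ.dir) => τ.dirProj (consSeq 0 b j)) ⟨0, h⟩
        (τ.dirProj u) := by
    intro u
    funext ⟨j, hj⟩
    cases j with
    | zero => simp [consSeq]
    | succ j => rw [Function.update_of_ne (by simp)]; simp [consSeq]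
  rw [vol, vol, hupd (-u), hupd u, map_neg, AlternatingMap.map_update_neg]

/-- Alternating forms ignore adding one argument to another. This trades `x'' - x` for `x'' - x'`
behind a first argument `x' - x`. -/
theorem vol_add (o : CellOrientations C v) (τ : Cell C v) (h : 1 < finrank ℝ τ.dir) (u y : E)
    (b : ℕ → E) : τ.vol o (consSeq u (consSeq (y + u) b)) = τ.vol o (consSeq u (consSeq y b)) := by
  have hupd : ∀ y : E,
      (fun j : Fin (finrank ℝ τ.dir) => τ.dirProj (consSeq u (consSeq y b) j)) =
      Function.update (fun j : Fin (finrank ℝ τ.dir) => τ.dirProj (consSeq u (consSeq 0 b) j))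
        ⟨1, h⟩ (τ.dirProj y) := by
    intro y
    funext ⟨j, hj⟩
    match j with
    | 0 => rw [Function.update_of_ne (by simp)]; simp [consSeq]
    | 1 => simp [consSeq]
    | j + 2 => rw [Function.update_of_ne (by simp)]; simp [consSeq]
  rw [vol, vol, hupd (y + u), hupd y, map_add, AlternatingMap.map_update_add, add_eq_left]
  refine AlternatingMap.map_eq_zero_of_eq _ _ (i := ⟨0, by omega⟩) (j := ⟨1, h⟩) ?_ (by simp)
  simp [consSeq]

/-- The contraction of a volume form of a cell with a vector, restricted to a boundary
component. -/
def contract {τ' τ : Cell C v} (hle : τ'.dir ≤ τ.dir)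
    (hdim : finrank ℝ τ.dir = finrank ℝ τ'.dir + 1)
    (ω : τ.dir [⋀^Fin (finrank ℝ τ.dir)]→ₗ[ℝ] ℝ) (u : τ.dir) :
    τ'.dir [⋀^Fin (finrank ℝ τ'.dir)]→ₗ[ℝ] ℝ :=
  ((ω.domDomCongr (finCongr hdim)).curryLeft u).compLinearMap (Submodule.inclusion hle)

/-- The hypotheses on `w` have the shape used in `OrientationAgrees`, so that the condition there
can be read as an equation for the contracted form. -/
theorem contract_apply {τ' τ : Cell C v} (hle : τ'.dir ≤ τ.dir)
    (hdim : finrank ℝ τ.dir = finrank ℝ τ'.dir + 1)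
    (ω : τ.dir [⋀^Fin (finrank ℝ τ.dir)]→ₗ[ℝ] ℝ) (u : τ.dir)
    (w' : Fin (finrank ℝ τ'.dir) → τ'.dir) (w : Fin (finrank ℝ τ.dir) → τ.dir)
    (h0 : ∀ j : Fin _, (j : ℕ) = 0 → (w j : E) = u)
    (h1 : ∀ (i : Fin _) (j : Fin _), (j : ℕ) = (i : ℕ) + 1 → (w j : E) = w' i) :
    contract hle hdim ω u w' = ω w := by
  simp only [contract, AlternatingMap.compLinearMap_apply, AlternatingMap.curryLeft_apply_apply,
    AlternatingMap.domDomCongr_apply]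
  congr 1
  funext j
  obtain ⟨j, hj⟩ := j
  apply Subtype.ext
  cases j with
  | zero =>
    rw [h0 ⟨0, hj⟩ rfl]
    rfl
  | succ j =>
    rw [h1 ⟨j, by omega⟩ ⟨j + 1, hj⟩ rfl]
    rfl

theorem vol_consSeq (o : CellOrientations C v) {τ' τ : Cell C v} (hle : τ'.dir ≤ τ.dir)
    (hdim : finrank ℝ τ.dir = finrank ℝ τ'.dir + 1) {u : E} (hu : u ∈ τ.dir) {b : ℕ → E}
    (hb : ∀ j < finrank ℝ τ'.dir, b j ∈ τ'.dir) :
    τ.vol o (consSeq u b) =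
      contract hle hdim (o τ).someVector ⟨u, hu⟩ fun j => τ'.dirProj (b j) := by
  rw [vol]
  refine (contract_apply hle hdim _ _ _ _ ?_ ?_).symm
  · rintro ⟨j, hj⟩ rfl
    simp [consSeq, dirProj_apply τ hu]
  · rintro ⟨i, hi⟩ ⟨j, hj⟩ rfl
    simp [consSeq, dirProj_apply τ' (hb i hi), dirProj_apply τ (hle (hb i hi))]

variable [FiniteDimensional ℝ E]

theorem exists_vol_ne_zero (o : CellOrientations C v) (τ : Cell C v) :
    ∃ b : ℕ → E, (∀ j < finrank ℝ τ.dir, b j ∈ τ.dir) ∧ τ.vol o b ≠ 0 := by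
  let e := Module.finBasis ℝ τ.dir
  refine ⟨fun j => if h : j < finrank ℝ τ.dir then e ⟨j, h⟩ else 0, fun j hj => ?_, ?_⟩
  · simp [hj]
  · have : (fun j : Fin (finrank ℝ τ.dir) => τ.dirProj
        (if h : (j : ℕ) < finrank ℝ τ.dir then (e ⟨j, h⟩ : E) else 0)) = e := by
      funext j
      rw [dif_pos j.2, dirProj_apply τ (e j).2]
    rw [vol, this]
    exact (AlternatingMap.map_basis_ne_zero_iff e _).2 (o τ).someVector_ne_zero

/-- A vector outside the smaller direction completes a basis of it to a basis of the larger one, on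
which a nonzero volume form cannot vanish; a vector inside gives a dependent family. -/
theorem contract_eq_zero_iff {τ' τ : Cell C v} (hle : τ'.dir ≤ τ.dir)
    (hdim : finrank ℝ τ.dir = finrank ℝ τ'.dir + 1)
    {ω : τ.dir [⋀^Fin (finrank ℝ τ.dir)]→ₗ[ℝ] ℝ} (hω : ω ≠ 0) (u : τ.dir) :
    contract hle hdim ω u = 0 ↔ (u : E) ∈ τ'.dir := by
  let e := Module.finBasis ℝ τ'.dir
  let w : Fin (finrank ℝ τ'.dir + 1) → τ.dir := Fin.cons u fun i => Submodule.inclusion hle (e i)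
  have hω' : ω.domDomCongr (finCongr hdim) ≠ 0 := fun h =>
    hω (AlternatingMap.ext fun x => by
      have := DFunLike.congr_fun h (x ∘ (finCongr hdim).symm)
      rw [AlternatingMap.domDomCongr_apply] at this
      simpa [Function.comp_def] using this)
  have hval : contract hle hdim ω u e = ω.domDomCongr (finCongr hdim) w := rfl
  have hspan : Submodule.span ℝ (Set.range fun i => Submodule.inclusion hle (e i)) =
      LinearMap.range (Submodule.inclusion hle) := by
    rw [show (fun i => Submodule.inclusion hle (e i)) = Submodule.inclusion hle ∘ e from rfl,
      Set.range_comp, Submodule.span_image, e.span_eq, Submodule.map_top]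
  have hmem : u ∈ LinearMap.range (Submodule.inclusion hle) ↔ (u : E) ∈ τ'.dir := by
    rw [Submodule.range_inclusion]
    rfl
  rw [← AlternatingMap.map_basis_eq_zero_iff e, hval]
  constructor
  · intro h0
    by_contra hu
    have hli : LinearIndependent ℝ w := by
      rw [linearIndependent_finCons, hspan, hmem]
      exact ⟨e.linearIndependent.map' _ (Submodule.ker_inclusion _ _ hle), hu⟩
    let B := basisOfLinearIndependentOfCardEqFinrank hli (by simp [hdim])
    have : (B : Fin _ → τ.dir) = w := coe_basisOfLinearIndependentOfCardEqFinrank hli _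
    rw [← this] at h0
    exact hω' ((AlternatingMap.map_basis_eq_zero_iff B _).1 h0)
  · intro hu
    refine AlternatingMap.map_linearDependent _ _ fun hli => ?_
    rw [linearIndependent_finCons, hspan, hmem] at hli
    exact hli.2 hu

/-- The quotient of the two directions is a line, and a normal in `τ.Ω \ τ'.Ω` is positive on every
vector from `τ` to `τ'`. So the outward vector is unique up to positive scale and tangent vectors,
and the induced orientation does not depend on the chosen points. -/
theorem exists_smul_add {τ' τ : Cell C v} (hΩ : τ'.Ω ⊆ τ.Ω)
    (hdim : finrank ℝ τ.dir = finrank ℝ τ'.dir + 1) {x x' y y' : E}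
    (hx : x ∈ cellSet C v τ.Ω) (hx' : x' ∈ cellSet C v τ'.Ω)
    (hy : y ∈ cellSet C v τ.Ω) (hy' : y' ∈ cellSet C v τ'.Ω) :
    ∃ c : ℝ, 0 < c ∧ ∃ t ∈ τ'.dir, y' - y = t + c • (x' - x) := by
  have hne : τ'.Ω ≠ τ.Ω := fun h => by
    rw [eq_of_Ω_eq h] at hdim
    omega
  have hle : τ'.dir ⊔ Submodule.span ℝ {x' - x} ≤ τ.dir :=
    sup_le (dir_mono hΩ) (by simpa using sub_mem_dir hΩ hx' hx)
  have hlt : τ'.dir < τ'.dir ⊔ Submodule.span ℝ {x' - x} := SetLike.lt_iff_le_and_exists.2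
    ⟨le_sup_left, _, Submodule.mem_sup_right (Submodule.mem_span_singleton_self _),
      sub_notMem_dir hΩ hne hx' hx⟩
  have h1 := Submodule.finrank_lt_finrank_of_lt hlt
  have heq := Submodule.eq_of_le_of_finrank_le hle (by omega)
  have hmem := sub_mem_dir hΩ hy' hy
  rw [← heq] at hmem
  obtain ⟨t, ht, z, hz, htz⟩ := Submodule.mem_sup.1 hmem
  obtain ⟨c, rfl⟩ := Submodule.mem_span_singleton.1 hz
  refine ⟨c, ?_, t, ht, htz.symm⟩
  obtain ⟨n, hn, hn'⟩ := Set.exists_of_ssubset (hΩ.ssubset_of_ne hne)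
  have h2 := congrArg (n : Dual ℝ E) htz
  rw [map_add, mem_dir.1 ht n hn', map_smul, map_sub, map_sub, hx'.2 n hn', hy'.2 n hn',
    smul_eq_mul, zero_add] at h2
  have := (hx.1 n hn).2
  have := (hy.1 n hn).2
  by_contra! hc
  nlinarith

/-- Volume forms on `τ'.dir` form a line, so the contraction of one of `τ` by an outward vector is
`r` times one of `τ'`, with `r ≠ 0`. The sign of `r` is the incidence sign, since changing points or
representing forms only introduces positive factors. -/
theorem exists_contract_eq (o : CellOrientations C v) {τ' τ : Cell C v} (hΩ : τ'.Ω ⊆ τ.Ω)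
    (hdim : finrank ℝ τ.dir = finrank ℝ τ'.dir + 1) {x x' : E}
    (hx : x ∈ cellSet C v τ.Ω) (hx' : x' ∈ cellSet C v τ'.Ω) :
    ∃ c : ℝ, 0 < c ∧ contract (dir_mono hΩ) hdim (o τ).someVector
      ⟨x' - x, sub_mem_dir hΩ hx' hx⟩ =
        ((incidenceSign o τ' τ : ℝ) * c) • (o τ').someVector := by
  have hne : τ'.Ω ≠ τ.Ω := fun h => by
    rw [eq_of_Ω_eq h] at hdim
    omega
  have hle := dir_mono hΩ
  have hu := sub_mem_dir hΩ hx' hx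
  have hω := (o τ).someVector_ne_zero
  have hω' := (o τ').someVector_ne_zero
  set ω := (o τ).someVector
  set ω' := (o τ').someVector
  let e := Module.finBasis ℝ τ'.dir
  obtain ⟨r, hr⟩ : ∃ r : ℝ, contract hle hdim ω ⟨x' - x, hu⟩ = r • ω' := by
    refine ⟨contract hle hdim ω ⟨x' - x, hu⟩ e / ω' e, ?_⟩
    have he := (AlternatingMap.map_basis_ne_zero_iff e _).2 hω'
    rw [(contract hle hdim ω ⟨x' - x, hu⟩).eq_smul_basis_det e, ω'.eq_smul_basis_det e]
    simp only [AlternatingMap.smul_apply, Basis.det_self, smul_eq_mul, mul_one, smul_smul]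
    rw [div_mul_cancel₀ _ he]
  have hr0 : r ≠ 0 := by
    rintro rfl
    rw [zero_smul, contract_eq_zero_iff hle hdim hω] at hr
    exact sub_notMem_dir hΩ hne hx' hx hr
  have hagree : OrientationAgrees o τ' τ ↔ 0 < r := by
    constructor
    · rintro ⟨y, hy, y', hy', ω₁, hω₁, ω₁', hω₁', h₁, h₁', hw⟩
      rw [← (o τ).someVector_ray, ray_eq_iff] at h₁
      rw [← (o τ').someVector_ray, ray_eq_iff] at h₁'
      obtain ⟨a, ha, rfl⟩ := h₁.symm.exists_pos_left hω hω₁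
      obtain ⟨a', ha', rfl⟩ := h₁'.symm.exists_pos_left hω' hω₁'
      obtain ⟨c, hc, t, ht, hyt⟩ := exists_smul_add hΩ hdim hx hx' hy hy'
      have hct : contract hle hdim ω ⟨y' - y, sub_mem_dir hΩ hy' hy⟩ = (c * r) • ω' := by
        have h0 := (contract_eq_zero_iff hle hdim hω ⟨t, hle ht⟩).2 ht
        have heq : (⟨y' - y, sub_mem_dir hΩ hy' hy⟩ : τ.dir) = ⟨t, hle ht⟩ + c • ⟨x' - x, hu⟩ :=
          Subtype.ext hyt
        rw [mul_smul, ← hr, heq]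
        simp only [contract, map_add, map_smul] at h0 ⊢
        ext w
        have := DFunLike.congr_fun h0 w
        simpa using this
      let w₀ : Fin (finrank ℝ τ'.dir + 1) → τ.dir :=
        Fin.cons ⟨y' - y, sub_mem_dir hΩ hy' hy⟩ fun i => Submodule.inclusion hle (e i)
      have hwe := hw (w₀ ∘ finCongr hdim) e
        (by rintro ⟨j, hj⟩ rfl; rfl)
        (by rintro ⟨i, hi⟩ ⟨j, hj⟩ rfl; rfl)
      have hce : contract hle hdim ω ⟨y' - y, sub_mem_dir hΩ hy' hy⟩ e =
        ω (w₀ ∘ finCongr hdim) := rfl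
      rw [AlternatingMap.smul_apply, ← hce, hct, AlternatingMap.smul_apply,
        AlternatingMap.smul_apply, smul_eq_mul, smul_eq_mul, smul_eq_mul, ← mul_assoc] at hwe
      have he := (AlternatingMap.map_basis_ne_zero_iff e _).2 hω'
      have := mul_right_cancel₀ he hwe
      rw [← mul_assoc] at this
      exact pos_of_mul_pos_right (by rw [this]; exact ha') (by positivity : 0 ≤ a * c)
    · intro hr0
      -- `OrientationAgrees` demands equality of the forms, not equality up to a positive factor;
      -- hence the rescaling by `r⁻¹`.
      refine ⟨x, hx, x', hx', r⁻¹ • ω, smul_ne_zero (inv_ne_zero hr0.ne') hω, ω', hω', ?_,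
        (o τ').someVector_ray, fun w w' h0 h1 => ?_⟩
      · rw [← (o τ).someVector_ray, ray_eq_iff]
        exact SameRay.sameRay_pos_smul_left _ (inv_pos.2 hr0)
      · rw [AlternatingMap.smul_apply, ← contract_apply hle hdim ω ⟨x' - x, hu⟩ w' w h0 h1, hr,
          AlternatingMap.smul_apply, smul_smul, inv_mul_cancel₀ hr0.ne', one_smul]
  by_cases h : OrientationAgrees o τ' τ
  · exact ⟨r, hagree.1 h, by rw [hr, incidenceSign, if_pos h]; simp⟩
  · refine ⟨-r, ?_, by rw [hr, incidenceSign, if_neg h]; simp⟩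
    have := lt_of_le_of_ne (not_lt.1 (hagree.not.1 h)) hr0
    linarith

theorem exists_vol_eq (o : CellOrientations C v) {τ' τ : Cell C v} (hΩ : τ'.Ω ⊆ τ.Ω)
    (hcodim : τ'.codim = τ.codim + 1) {x x' : E}
    (hx : x ∈ cellSet C v τ.Ω) (hx' : x' ∈ cellSet C v τ'.Ω) :
    ∃ c : ℝ, 0 < c ∧ ∀ b : ℕ → E, (∀ j < finrank ℝ τ'.dir, b j ∈ τ'.dir) →
      τ.vol o (consSeq (x' - x) b) = incidenceSign o τ' τ * c * τ'.vol o b := by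
  have hdim : finrank ℝ τ.dir = finrank ℝ τ'.dir + 1 := by
    have := τ.codim_add_finrank
    have := τ'.codim_add_finrank
    omega
  obtain ⟨c, hc, h⟩ := exists_contract_eq o hΩ hdim hx hx'
  refine ⟨c, hc, fun b hb => ?_⟩
  rw [vol_consSeq o (dir_mono hΩ) hdim (sub_mem_dir hΩ hx' hx) hb, h]
  rfl

/-- Up to a positive factor, the product of signs along a path `τ'', τ', τ` is the volume in `τ` of
`x' - x`, `x'' - x` and a frame of `τ''`. If `x` is the midpoint of points of `τ₁` and `τ₂`, the
first arguments for the two paths are opposite while all others agree. -/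
theorem incidenceSign_diamond (o : CellOrientations C v) {τ'' τ₁ τ₂ τ : Cell C v}
    (h1 : τ''.Ω ⊆ τ₁.Ω) (h1' : τ₁.Ω ⊆ τ.Ω) (h2 : τ''.Ω ⊆ τ₂.Ω) (h2' : τ₂.Ω ⊆ τ.Ω)
    (hunion : τ.Ω ⊆ τ₁.Ω ∪ τ₂.Ω) (hc : τ''.codim = τ.codim + 2)
    (hc1 : τ₁.codim = τ.codim + 1) (hc2 : τ₂.codim = τ.codim + 1) :
    incidenceSign o τ'' τ₁ * incidenceSign o τ₁ τ +
      incidenceSign o τ'' τ₂ * incidenceSign o τ₂ τ = 0 := by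
  have hd := τ.codim_add_finrank
  have hd1 := τ₁.codim_add_finrank
  have hd2 := τ₂.codim_add_finrank
  have hd'' := τ''.codim_add_finrank
  obtain ⟨x₁, hx₁⟩ := τ₁.nonempty
  obtain ⟨x₂, hx₂⟩ := τ₂.nonempty
  obtain ⟨x'', hx''⟩ := τ''.nonempty
  set x : E := (1 / 2 : ℝ) • (x₁ + x₂) with hxdef
  have hn : ∀ n : Dual ℝ E, n x = (n x₁ + n x₂) / 2 := fun n => by
    rw [hxdef, map_smul, map_add, smul_eq_mul]
    ring
  have hx : x ∈ cellSet C v τ.Ω := by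
    refine ⟨fun n hnΩ => ?_, fun n hnΩ => ?_⟩
    · rw [hn]
      have ha : ∀ τ' : Cell C v, ∀ y ∈ cellSet C v τ'.Ω,
          (⌈(n : Dual ℝ E) v⌉ : ℝ) - 1 < (n : Dual ℝ E) y ∧
            (n : Dual ℝ E) y ≤ (⌈(n : Dual ℝ E) v⌉ : ℝ) := by
        intro τ' y hy
        by_cases h : n ∈ τ'.Ω
        · exact ⟨(hy.1 n h).1, (hy.1 n h).2.le⟩
        · rw [hy.2 n h]
          exact ⟨sub_one_lt _, le_rfl⟩
      have a1 := ha τ₁ x₁ hx₁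
      have a2 := ha τ₂ x₂ hx₂
      refine ⟨by linarith, ?_⟩
      -- At the midpoint the upper inequality is strict as soon as it is strict at one end; this is
      -- why `hunion` is needed.
      rcases hunion hnΩ with h | h
      · linarith [(hx₁.1 n h).2]
      · linarith [(hx₂.1 n h).2]
    · rw [hn, hx₁.2 n fun h => hnΩ (h1' h), hx₂.2 n fun h => hnΩ (h2' h)]
      ring
  obtain ⟨b, hb, hb0⟩ := exists_vol_ne_zero o τ''
  have key : ∀ τ' : Cell C v, τ''.Ω ⊆ τ'.Ω → τ'.Ω ⊆ τ.Ω → τ'.codim = τ.codim + 1 →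
      ∀ x' ∈ cellSet C v τ'.Ω, ∃ c : ℝ, 0 < c ∧
        τ.vol o (consSeq (x' - x) (consSeq (x'' - x) b)) =
          ((incidenceSign o τ'' τ' * incidenceSign o τ' τ : ℤ) : ℝ) * c * τ''.vol o b := by
    intro τ' g g' hc' x' hx'
    have hd' := τ'.codim_add_finrank
    obtain ⟨c, hc0, h⟩ := exists_vol_eq o g' hc' hx hx'
    obtain ⟨c', hc0', h'⟩ := exists_vol_eq o g (by omega) hx' hx''
    refine ⟨c * c', mul_pos hc0 hc0', ?_⟩
    have e1 : x'' - x = (x'' - x') + (x' - x) := by abel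
    rw [e1, vol_add o τ (by omega), h, h' b hb]
    · push_cast
      ring
    · intro j hj
      cases j with
      | zero => exact sub_mem_dir g hx'' hx'
      | succ j => exact dir_mono g (hb j (by omega))
  obtain ⟨c₁, hc₁, e₁⟩ := key τ₁ h1 h1' hc1 x₁ hx₁
  obtain ⟨c₂, hc₂, e₂⟩ := key τ₂ h2 h2' hc2 x₂ hx₂
  have hneg : x₂ - x = -(x₁ - x) := by
    rw [hxdef]
    module
  rw [hneg, vol_neg o τ (by omega), e₁] at e₂
  have hsum : ((incidenceSign o τ'' τ₁ * incidenceSign o τ₁ τ : ℤ) : ℝ) * c₁ +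
      ((incidenceSign o τ'' τ₂ * incidenceSign o τ₂ τ : ℤ) : ℝ) * c₂ = 0 :=
    mul_right_cancel₀ hb0 (by linarith)
  have hsign : ∀ σ σ' : Cell C v, incidenceSign o σ σ' = 1 ∨ incidenceSign o σ σ' = -1 := by
    intro σ σ'
    unfold incidenceSign
    split_ifs <;> simp
  rcases hsign τ'' τ₁ with a | a <;> rcases hsign τ₁ τ with b | b <;>
    rcases hsign τ'' τ₂ with c | c <;> rcases hsign τ₂ τ with d | d <;>
    rw [a, b, c, d] at hsum ⊢ <;> norm_num at hsum ⊢ <;> linarith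

end Cell

end Orientations

/-! ### The cellular complex and its exactness on intervals of cells -/

section CellComplex

open Filter Topology

variable {C : ToricCone L} {v : E}

instance : Fintype (Cell C v) := Fintype.ofFinite _

theorem incidenceSign_mul_self (o : CellOrientations C v) (τ' τ : Cell C v) :
    incidenceSign o τ' τ * incidenceSign o τ' τ = 1 := by
  unfold incidenceSign
  split_ifs <;> rfl

open Classical in
/-- The incidence number of two cells. -/
def incidence (o : CellOrientations C v) (τ' τ : Cell C v) : ℤ :=
  if τ'.Ω ⊆ τ.Ω ∧ τ'.codim = τ.codim + 1 then incidenceSign o τ' τ else 0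

theorem incidence_of_pos {o : CellOrientations C v} {τ' τ : Cell C v}
    (h : τ'.Ω ⊆ τ.Ω ∧ τ'.codim = τ.codim + 1) : incidence o τ' τ = incidenceSign o τ' τ :=
  if_pos h

theorem incidence_ne_zero {o : CellOrientations C v} {τ' τ : Cell C v}
    (h : incidence o τ' τ ≠ 0) : τ'.Ω ⊆ τ.Ω ∧ τ'.codim = τ.codim + 1 := by
  by_contra h'
  exact h (if_neg h')

theorem incidence_self (o : CellOrientations C v) (τ : Cell C v) : incidence o τ τ = 0 := by
  by_contra h
  have := (incidence_ne_zero h).2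
  omega

variable (k : Type*) [Field k]

/-- The differential of the cellular complex of a chamber, on all cells at once. -/
def cellDiff (o : CellOrientations C v) : (Cell C v → k) →ₗ[k] (Cell C v → k) where
  toFun f τ := ∑ τ', (incidence o τ' τ : k) * f τ'
  map_add' f g := by
    funext τ
    simp [mul_add, Finset.sum_add_distrib]
  map_smul' c f := by
    funext τ
    simp [Finset.mul_sum, mul_left_comm]

variable {k}

theorem cellDiff_apply (o : CellOrientations C v) (f : Cell C v → k) (τ : Cell C v) :
    cellDiff k o f τ = ∑ τ', (incidence o τ' τ : k) * f τ' := rfl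

theorem cellDiff_eq_zero_of {o : CellOrientations C v} {f : Cell C v → k} {τ : Cell C v}
    (h : ∀ τ', f τ' ≠ 0 → incidence o τ' τ = 0) : cellDiff k o f τ = 0 := by
  rw [cellDiff_apply]
  refine Finset.sum_eq_zero fun τ' _ => ?_
  by_cases hf : f τ' = 0
  · rw [hf, mul_zero]
  · rw [h τ' hf, Int.cast_zero, zero_mul]

/-- The cells `τ_Ω` with `A ⊆ Ω ⊆ U`. -/
def cellInterval (A U : Set C.normals) : Set (Cell C v) := {τ | A ⊆ τ.Ω ∧ τ.Ω ⊆ U}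

variable (k) in
/-- Exactness of the cellular complex restricted to a set of cells. -/
def ExactOn (o : CellOrientations C v) (F : Set (Cell C v)) : Prop :=
  ∀ f : Cell C v → k, (∀ τ ∉ F, f τ = 0) → (∀ τ ∈ F, cellDiff k o f τ = 0) →
    ∃ g : Cell C v → k, (∀ τ ∉ F, g τ = 0) ∧ ∀ τ ∈ F, cellDiff k o g τ = f τ

/-- The complex is a single map between one-dimensional spaces, multiplication by a sign. -/
theorem exactOn_pair (o : CellOrientations C v) {τ' τ : Cell C v} (hΩ : τ'.Ω ⊆ τ.Ω)
    (hcodim : τ'.codim = τ.codim + 1) {F : Set (Cell C v)} (hF : F = {τ', τ}) :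
    ExactOn k o F := by
  classical
  subst hF
  have hne : τ' ≠ τ := by
    rintro rfl
    omega
  have hsq : (incidenceSign o τ' τ : k) * (incidenceSign o τ' τ : k) = 1 := by
    exact_mod_cast congrArg (Int.cast : ℤ → k) (incidenceSign_mul_self o τ' τ)
  intro f hf hcyc
  have hdiff : ∀ g : Cell C v → k, (∀ σ ∉ ({τ', τ} : Set (Cell C v)), g σ = 0) →
      cellDiff k o g τ = incidenceSign o τ' τ * g τ' := by
    intro g hg
    rw [cellDiff_apply, ← Finset.sum_subset (Finset.subset_univ {τ', τ}), Finset.sum_pair hne,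
      incidence_of_pos ⟨hΩ, hcodim⟩, incidence_self, Int.cast_zero, zero_mul, add_zero]
    intro σ _ hσ
    rw [hg σ (by simpa using hσ), mul_zero]
  have hf' : f τ' = 0 := by
    have h := hcyc τ (by simp)
    rw [hdiff f hf] at h
    rw [← one_mul (f τ'), ← hsq, mul_assoc, h, mul_zero]
  have hg : ∀ σ ∉ ({τ', τ} : Set (Cell C v)),
      (Pi.single τ' ((incidenceSign o τ' τ : k) * f τ) : Cell C v → k) σ = 0 := by
    intro σ hσ
    rw [Pi.single_eq_of_ne fun h => hσ (by simp [h])]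
  refine ⟨Pi.single τ' (incidenceSign o τ' τ * f τ), hg, ?_⟩
  rintro σ (rfl | rfl)
  · rw [hf']
    refine cellDiff_eq_zero_of fun σ' hσ' => ?_
    by_cases h : σ' = σ
    · rw [h, incidence_self]
    · exact absurd (Pi.single_eq_of_ne h _) hσ'
  · rw [hdiff _ hg, Pi.single_eq_same, ← mul_assoc, hsq, one_mul]

/-- A point of the open cell `τ_U` in general position as seen from `w`. -/
theorem exists_generic_point {A U : Set C.normals} {w : E}
    (hU : ∀ n ∉ U, (n : Dual ℝ E) w = ⌈(n : Dual ℝ E) v⌉)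
    (hJ : ∀ n ∈ U \ A, (⌈(n : Dual ℝ E) v⌉ : ℝ) < (n : Dual ℝ E) w)
    {τ₀ : Cell C v} (hτ₀ : τ₀ ∈ cellInterval A U) (ℓ : C.normals × C.normals → Dual ℝ E) :
    ∃ y ∈ cellSet C v U, ∀ ij, ℓ ij (y - w) = 0 →
      ∀ t, (∀ n ∉ U, (n : Dual ℝ E) t = 0) → ℓ ij t = 0 := by
  obtain ⟨x₀, hx₀⟩ := τ₀.nonempty
  -- Moving from a point of `τ₀` away from `w` leaves every facet in `U` on the inner side, because
  -- `w` is beyond those it touches.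
  obtain ⟨ε, hy₀, -⟩ := ((eventually_add_smul_mem_cellSet hτ₀.2 (t := x₀ - w) hx₀
    (fun n hn hn' => by
      rw [map_sub, hx₀.2 n hn', sub_neg]
      exact hJ n ⟨hn, fun h => hn' (hτ₀.1 h)⟩)
    (fun n hn => by
      rw [map_sub, hx₀.2 n fun h => hn (hτ₀.2 h), hU n hn, sub_self])).and
    self_mem_nhdsWithin).exists
  set y₀ := x₀ + ε • (x₀ - w)
  let D : Submodule ℝ E := ⨅ n : {n : C.normals // n ∉ U}, LinearMap.ker (n : Dual ℝ E)
  have hD : ∀ t, t ∈ D ↔ ∀ n ∉ U, (n : Dual ℝ E) t = 0 := fun t => by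
    simp [D, Submodule.mem_iInf]
  -- One direction `p` avoids the finitely many proper subspaces where a form not identically zero
  -- on `D` vanishes; a small step along it makes `y₀` generic.
  obtain ⟨p, hpD, hp⟩ := Module.Dual.exists_forall_mem_ne_zero_of_forall_exists D
    (fun ij : {ij : C.normals × C.normals // ∃ t ∈ D, ℓ ij t ≠ 0} => ℓ ij) fun ij => ij.2
  have hgen : ∀ᶠ ε : ℝ in 𝓝[>] 0, ∀ ij : {ij : C.normals × C.normals // ∃ t ∈ D, ℓ ij t ≠ 0},
      ℓ ij (y₀ + ε • p - w) ≠ 0 := by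
    rw [eventually_all]
    intro ij
    have hval : ∀ ε : ℝ, ℓ ij (y₀ + ε • p - w) = ℓ ij (y₀ - w) + ε * ℓ ij p := fun ε => by
      rw [add_sub_right_comm, map_add, map_smul, smul_eq_mul]
    by_cases h0 : ℓ ij (y₀ - w) = 0
    · filter_upwards [self_mem_nhdsWithin] with ε hε
      rw [hval, h0, zero_add]
      exact mul_ne_zero (ne_of_gt hε) (hp ij)
    · have hlim : Tendsto (fun ε : ℝ => ℓ ij (y₀ - w) + ε * ℓ ij p) (𝓝[>] 0)
          (𝓝 (ℓ ij (y₀ - w) + 0 * ℓ ij p)) :=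
        tendsto_nhdsWithin_of_tendsto_nhds (Continuous.tendsto (by fun_prop) 0)
      rw [zero_mul, add_zero] at hlim
      filter_upwards [hlim.eventually_ne h0] with ε hε
      rwa [hval]
  obtain ⟨ε', h1, h2⟩ := ((eventually_add_smul_mem_cellSet subset_rfl (t := p) hy₀
    (fun n hn hn' => absurd hn hn') ((hD p).1 hpD)).and hgen).exists
  refine ⟨_, h1, fun ij h0 t ht => ?_⟩
  by_contra h
  exact h2 ⟨ij, t, (hD t).2 ht, h⟩ h0

variable [FiniteDimensional ℝ E]

/-- Nonzero terms come from cells strictly between two incident cells whose codimensions differ by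
two: exactly two cells, with opposite contributions. -/
theorem sum_incidence_mul_incidence (o : CellOrientations C v) (τ'' τ : Cell C v) :
    ∑ τ', incidence o τ'' τ' * incidence o τ' τ = 0 := by
  classical
  by_cases h : τ''.Ω ⊆ τ.Ω ∧ τ''.codim = τ.codim + 2
  · obtain ⟨τ₁, τ₂, hne, h1, h1', h2, h2', hc1, hc2, hun, huniq⟩ := Cell.exists_diamond h.1 h.2
    have hc := h.2
    rw [← Finset.sum_subset (Finset.subset_univ {τ₁, τ₂}), Finset.sum_pair hne,
      incidence_of_pos ⟨h1, by omega⟩, incidence_of_pos ⟨h1', hc1⟩,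
      incidence_of_pos ⟨h2, by omega⟩, incidence_of_pos ⟨h2', hc2⟩]
    · exact Cell.incidenceSign_diamond o h1 h1' h2 h2' hun hc hc1 hc2
    · intro τ' _ hτ'
      by_contra h0
      have ha := incidence_ne_zero (left_ne_zero_of_mul h0)
      have hb := incidence_ne_zero (right_ne_zero_of_mul h0)
      rcases huniq τ' ha.1 hb.1 hb.2 with rfl | rfl <;> simp at hτ'
  · refine Finset.sum_eq_zero fun τ' _ => ?_
    by_contra h0
    have ha := incidence_ne_zero (left_ne_zero_of_mul h0)
    have hb := incidence_ne_zero (right_ne_zero_of_mul h0)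
    exact h ⟨ha.1.trans hb.1, by omega⟩

theorem cellDiff_cellDiff (o : CellOrientations C v) (f : Cell C v → k) :
    cellDiff k o (cellDiff k o f) = 0 := by
  funext τ
  simp only [cellDiff_apply, Finset.mul_sum]
  rw [Finset.sum_comm, Pi.zero_apply]
  refine Finset.sum_eq_zero fun τ'' _ => ?_
  have h := congrArg (Int.cast : ℤ → k) (sum_incidence_mul_incidence o τ'' τ)
  push_cast at h
  have : ∑ τ', (incidence o τ' τ : k) * ((incidence o τ'' τ' : k) * f τ'') =
      (∑ τ', (incidence o τ'' τ' : k) * (incidence o τ' τ : k)) * f τ'' := by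
    rw [Finset.sum_mul]
    exact Finset.sum_congr rfl fun _ _ => by ring
  rw [this, h, zero_mul]

/-- Intervals are convex: a chain of incident cells with both ends inside has its middle inside.
Cutting the differential down to an interval therefore keeps its square zero. -/
theorem cellDiff_indicator_cellDiff (o : CellOrientations C v) {A U : Set C.normals}
    {f : Cell C v → k} (hf : ∀ τ ∉ cellInterval A U, f τ = 0) {τ : Cell C v}
    (hτ : τ ∈ cellInterval A U) :
    cellDiff k o ((cellInterval A U).indicator (cellDiff k o f)) τ = 0 := by
  classical
  have hzero : cellDiff k o (cellDiff k o f) τ = 0 := congrFun (cellDiff_cellDiff o f) τ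
  rw [← hzero, cellDiff_apply, cellDiff_apply]
  refine Finset.sum_congr rfl fun τ' _ => ?_
  by_cases hτ' : τ' ∈ cellInterval A U
  · rw [Set.indicator_of_mem hτ']
  · rw [Set.indicator_of_notMem hτ', mul_zero, eq_comm]
    by_cases hi : incidence o τ' τ = 0
    · rw [hi, Int.cast_zero, zero_mul]
    · rw [cellDiff_eq_zero_of, mul_zero]
      intro τ'' hτ''
      by_contra hi'
      have hmem : τ'' ∈ cellInterval A U := by
        by_contra h
        exact hτ'' (hf τ'' h)
      exact hτ' ⟨hmem.1.trans (incidence_ne_zero hi').1, (incidence_ne_zero hi).1.trans hτ.2⟩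

/-- By `h12` the cells in `F₁` form a subcomplex with quotient `F₂`, and exactness passes to
extensions: lift the part of a cycle on `F₂`, subtract the boundary, and lift the remainder on `F₁`.
-/
theorem ExactOn.union {o : CellOrientations C v} {A U : Set C.normals} {F₁ F₂ : Set (Cell C v)}
    (hF : cellInterval A U = F₁ ∪ F₂)
    (h12 : ∀ τ' ∈ F₁, ∀ τ ∈ F₂, incidence o τ' τ = 0)
    (h₁ : ExactOn k o F₁) (h₂ : ExactOn k o F₂) : ExactOn k o (cellInterval A U) := by
  classical
  intro f hf hcyc
  have hF₁ : F₁ ⊆ cellInterval A U := hF ▸ Set.subset_union_left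
  have hF₂ : F₂ ⊆ cellInterval A U := hF ▸ Set.subset_union_right
  obtain ⟨g₂, hg₂, hd₂⟩ := h₂ (F₂.indicator f) (fun τ hτ => Set.indicator_of_notMem hτ _) (by
    intro τ hτ
    rw [← hcyc τ (hF₂ hτ), ← sub_eq_zero, ← Pi.sub_apply, ← map_sub]
    refine cellDiff_eq_zero_of fun τ' hτ' => ?_
    by_contra hi
    have hτ'₂ : τ' ∉ F₂ := fun h => hτ' (by simp [h])
    have hτ'F : τ' ∈ cellInterval A U := by
      by_contra h
      exact hτ' (by simp [hτ'₂, hf τ' h])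
    rw [hF] at hτ'F
    exact hi (h12 τ' (hτ'F.resolve_right hτ'₂) τ hτ))
  have hg₂' : ∀ τ ∉ cellInterval A U, g₂ τ = 0 := fun τ hτ => hg₂ τ fun h => hτ (hF₂ h)
  obtain ⟨g₁, hg₁, hd₁⟩ := h₁ (f - (cellInterval A U).indicator (cellDiff k o g₂)) (by
    intro τ hτ
    by_cases hτF : τ ∈ cellInterval A U
    · have hτ₂ : τ ∈ F₂ := by
        rw [hF] at hτF
        exact hτF.resolve_left hτ
      simp [hτF, hd₂ τ hτ₂, hτ₂]
    · simp [hτF, hf τ hτF]) (by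
    intro τ hτ
    rw [map_sub, Pi.sub_apply, hcyc τ (hF₁ hτ), cellDiff_indicator_cellDiff o hg₂' (hF₁ hτ),
      sub_zero])
  refine ⟨g₁ + g₂, fun τ hτ => ?_, fun τ hτ => ?_⟩
  · rw [Pi.add_apply, hg₁ τ fun h => hτ (hF₁ h), hg₂' τ hτ, add_zero]
  · rw [map_add, Pi.add_apply]
    have hτ' := hτ
    rw [hF] at hτ'
    rcases hτ' with h | h
    · rw [hd₁ τ h, Pi.sub_apply, Set.indicator_of_mem hτ, sub_add_cancel]
    · rw [hd₂ τ h, Set.indicator_of_mem h, add_eq_right]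
      refine cellDiff_eq_zero_of fun τ' hτ' => h12 τ' ?_ τ h
      by_contra h'
      exact hτ' (hg₁ τ' h')

theorem Cell.codim_eq_of_forall_zero {τ' τ : Cell C v} (hΩ : τ'.Ω ⊆ τ.Ω) (hne : τ'.Ω ≠ τ.Ω)
    (n : C.normals) (hn : ∀ t ∈ τ.dir, (n : Dual ℝ E) t = 0 → t ∈ τ'.dir) :
    τ'.codim = τ.codim + 1 := by
  have h1 := Cell.finrank_lt hΩ hne
  let φ : τ.dir →ₗ[ℝ] ℝ := (n : Dual ℝ E) ∘ₗ τ.dir.subtype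
  have h2 := LinearMap.finrank_range_add_finrank_ker φ
  have h3 : finrank ℝ (LinearMap.range φ) ≤ 1 := by
    simpa using Submodule.finrank_le (LinearMap.range φ)
  have h4 : finrank ℝ (LinearMap.ker φ) ≤ finrank ℝ τ'.dir := by
    rw [← Submodule.finrank_map_subtype_eq]
    refine Submodule.finrank_mono ?_
    rintro _ ⟨t, ht, rfl⟩
    exact hn t t.2 ht
  have := τ.codim_add_finrank
  have := τ'.codim_add_finrank
  omega

/-- The complex of the cells of a chamber that lie on none of the facets in `A`, and on all
facets outside `U`, is exact as soon as some point lies beyond exactly the facets in `U \ A`. -/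
theorem exactOn_cellInterval (o : CellOrientations C v) (A U : Set C.normals) (hAU : A ⊆ U)
    (hne : A ≠ U) (w : E)
    (hA : ∀ n ∈ A, (⌈(n : Dual ℝ E) v⌉ : ℝ) - 1 < (n : Dual ℝ E) w ∧
      (n : Dual ℝ E) w < ⌈(n : Dual ℝ E) v⌉)
    (hU : ∀ n ∉ U, (n : Dual ℝ E) w = ⌈(n : Dual ℝ E) v⌉)
    (hJ : ∀ n ∈ U \ A, (⌈(n : Dual ℝ E) v⌉ : ℝ) < (n : Dual ℝ E) w) :
    ExactOn k o (cellInterval A U) := by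
  induction hcard : (U \ A).ncard using Nat.strong_induction_on generalizing A U w with
  | _ N ih =>
  subst hcard
  by_cases hemp : (cellInterval A U : Set (Cell C v)).Nonempty
  swap
  · rw [Set.not_nonempty_iff_eq_empty] at hemp
    rw [hemp]
    exact fun f _ _ => ⟨0, fun _ _ => rfl, fun _ h => absurd h (Set.notMem_empty _)⟩
  obtain ⟨τ₀, hτ₀⟩ := hemp
  set d : C.normals → ℝ := fun n => ⌈(n : Dual ℝ E) v⌉ with hd
  -- For two normals in `U \ A`, this form vanishes at `y - w` iff the segment from `w` to `y`
  -- crosses both walls at the same time. By genericity it then vanishes in all directions of the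
  -- cell, so the walls coincide on its affine span.
  obtain ⟨y, hy, hgen⟩ := exists_generic_point hU hJ hτ₀ fun ij =>
    ((ij.2 : Dual ℝ E) w - d ij.2) • (ij.1 : Dual ℝ E) -
      ((ij.1 : Dual ℝ E) w - d ij.1) • (ij.2 : Dual ℝ E)
  have hyA : ∀ n ∈ A, d n - 1 < (n : Dual ℝ E) y ∧ (n : Dual ℝ E) y < d n := fun n hn =>
    hy.1 n (hAU hn)
  have hyJ : ∀ n ∈ U \ A, d n - 1 < (n : Dual ℝ E) y ∧ (n : Dual ℝ E) y < d n := fun n hn =>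
    hy.1 n hn.1
  have hyU : ∀ n ∉ U, (n : Dual ℝ E) y = d n := hy.2
  -- The time at which the segment from `w` to `y` crosses the wall of `n`.
  let s : C.normals → ℝ := fun n =>
    ((n : Dual ℝ E) w - d n) / ((n : Dual ℝ E) w - (n : Dual ℝ E) y)
  have hden : ∀ n ∈ U \ A, 0 < (n : Dual ℝ E) w - (n : Dual ℝ E) y := fun n hn => by
    linarith [hJ n hn, (hyJ n hn).2]
  have hs : ∀ n ∈ U \ A, s n * ((n : Dual ℝ E) w - (n : Dual ℝ E) y) = (n : Dual ℝ E) w - d n :=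
    fun n hn => div_mul_cancel₀ _ (hden n hn).ne'
  have hs0 : ∀ n ∈ U \ A, 0 < s n := fun n hn =>
    div_pos (sub_pos.2 (hJ n hn)) (hden n hn)
  have hs1 : ∀ n ∈ U \ A, s n < 1 := fun n hn => by
    rw [div_lt_one (hden n hn)]
    linarith [(hyJ n hn).2]
  obtain ⟨n₀, hn₀, hmin⟩ := Set.exists_min_image (U \ A) s (Set.toFinite _)
    ((Set.exists_of_ssubset (hAU.ssubset_of_ne hne)).imp fun n h => ⟨h.1, h.2⟩)
  -- The walls crossed first. They coincide on the affine span of the cell `U`, so each cell of the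
  -- interval lies on all of them or on none.
  let K : Set C.normals := {n | n ∈ U \ A ∧ s n = s n₀}
  have hn₀K : n₀ ∈ K := ⟨hn₀, rfl⟩
  have hKU : K ⊆ U := fun n hn => hn.1.1
  have hKA : ∀ n ∈ K, n ∉ A := fun n hn => hn.1.2
  have hprop : ∀ n ∈ K, ∀ x, (∀ m ∉ U, (m : Dual ℝ E) x = d m) →
      ((n₀ : Dual ℝ E) w - d n₀) * ((n : Dual ℝ E) x - d n) =
        ((n : Dual ℝ E) w - d n) * ((n₀ : Dual ℝ E) x - d n₀) := by
    intro n hn x hx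
    have h := hgen (n, n₀) (by
      have h1 := hs n hn.1
      have h2 := hs n₀ hn₀
      rw [hn.2] at h1
      simp only [LinearMap.sub_apply, LinearMap.smul_apply, smul_eq_mul, map_sub]
      rw [← h1, ← h2]
      ring) (x - w) fun m hm => by rw [map_sub, hx m hm, hU m hm, sub_self]
    simp only [LinearMap.sub_apply, LinearMap.smul_apply, smul_eq_mul, map_sub] at h
    linarith
  have hK : ∀ τ ∈ (cellInterval A U : Set (Cell C v)), ∀ n ∈ K, n ∈ τ.Ω ↔ n₀ ∈ τ.Ω := by
    intro τ hτ n hn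
    obtain ⟨x, hx⟩ := τ.nonempty
    have h := hprop n hn x fun m hm => hx.2 m fun h => hm (hτ.2 h)
    have h1 : 0 < (n₀ : Dual ℝ E) w - d n₀ := sub_pos.2 (hJ n₀ hn₀)
    have h2 : 0 < (n : Dual ℝ E) w - d n := sub_pos.2 (hJ n hn.1)
    constructor
    · intro hnΩ
      by_contra h0
      rw [hx.2 n₀ h0, sub_self, mul_zero, mul_eq_zero] at h
      have := (hx.1 n hnΩ).2
      rcases h with h | h <;> linarith
    · intro hnΩ
      by_contra h0
      rw [hx.2 n h0, sub_self, mul_zero, eq_comm, mul_eq_zero] at h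
      have := (hx.1 n₀ hnΩ).2
      rcases h with h | h <;> linarith
  have hval : ∀ (r : ℝ) (n : Dual ℝ E), n (w + r • (y - w)) = n w - r * (n w - n y) := by
    intro r n
    rw [map_add, map_smul, map_sub, smul_eq_mul]
    ring
  have hconv : ∀ r : ℝ, 0 < r → r < 1 → ∀ n ∈ A,
      d n - 1 < (n : Dual ℝ E) (w + r • (y - w)) ∧ (n : Dual ℝ E) (w + r • (y - w)) < d n := by
    intro r hr0 hr1 n hn
    have h1 := hA n hn
    have h2 := hyA n hn
    rw [hval]
    constructor <;> nlinarith
  have hconvU : ∀ r : ℝ, ∀ n ∉ U, (n : Dual ℝ E) (w + r • (y - w)) = d n := by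
    intro r n hn
    rw [hval, hyU n hn, hU n hn]
    simp [hd]
  have hlow : ∀ r : ℝ, 0 < r → r < 1 → ∀ n ∈ U \ A, d n - 1 < (n : Dual ℝ E) (w + r • (y - w)) := by
    intro r hr0 hr1 n hn
    have h1 := hJ n hn
    have h2 := hyJ n hn
    rw [hval]
    nlinarith
  have hbefore : ∀ r : ℝ, ∀ n ∈ U \ A, r < s n → d n < (n : Dual ℝ E) (w + r • (y - w)) := by
    intro r n hn hr
    rw [hval]
    nlinarith [hs n hn, hden n hn]
  have hafter : ∀ r : ℝ, ∀ n ∈ U \ A, s n < r → (n : Dual ℝ E) (w + r • (y - w)) < d n := by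
    intro r n hn hr
    rw [hval]
    nlinarith [hs n hn, hden n hn]
  have hat : ∀ n ∈ K, (n : Dual ℝ E) (w + s n₀ • (y - w)) = d n := by
    intro n hn
    rw [hval, ← hn.2, hs n hn.1]
    ring
  -- If no other wall remains, the crossing point lies in the cell `A`, and the interval consists of
  -- that cell and the cell `U`, of codimensions differing by one.
  by_cases hAK : A ∪ K = U
  · have hw' : w + s n₀ • (y - w) ∈ cellSet C v A := by
      refine ⟨hconv _ (hs0 n₀ hn₀) (hs1 n₀ hn₀), fun n hn => ?_⟩
      by_cases hnU : n ∈ U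
      · rw [← hAK] at hnU
        exact hat n (hnU.resolve_left hn)
      · exact hconvU _ n hnU
    let τ' : Cell C v := ⟨A, _, hw'⟩
    let τ : Cell C v := ⟨U, _, hy⟩
    refine exactOn_pair o (τ' := τ') (τ := τ) hAU
      (Cell.codim_eq_of_forall_zero hAU hne n₀ fun t ht ht0 => ?_) ?_
    · refine Cell.mem_dir.2 fun n hn => ?_
      by_cases hnU : n ∈ U
      · rw [← hAK] at hnU
        have h := hprop n (hnU.resolve_left hn) (y + t) fun m hm => by
          rw [map_add, hyU m hm, Cell.mem_dir.1 ht m hm, add_zero]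
        have h' := hprop n (hnU.resolve_left hn) y hyU
        rw [map_add, map_add, ht0, add_zero, ← h'] at h
        have h1 : 0 < (n₀ : Dual ℝ E) w - d n₀ := sub_pos.2 (hJ n₀ hn₀)
        have := mul_left_cancel₀ h1.ne' h
        linarith
      · exact Cell.mem_dir.1 ht n hnU
    · ext σ
      constructor
      · intro hσ
        by_cases h : n₀ ∈ σ.Ω
        · refine Or.inr (Cell.eq_of_Ω_eq (hσ.2.antisymm ?_))
          change U ⊆ σ.Ω
          rw [← hAK]
          exact Set.union_subset hσ.1 fun n hn => (hK σ hσ n hn).2 h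
        · refine Or.inl (Cell.eq_of_Ω_eq (Set.Subset.antisymm (fun n hn => ?_) hσ.1))
          have hnU := hσ.2 hn
          rw [← hAK] at hnU
          exact hnU.resolve_right fun hnK => h ((hK σ hσ n hnK).1 hn)
      · rintro (rfl | rfl)
        exacts [⟨subset_rfl, hAU⟩, ⟨hAU, subset_rfl⟩]
  have hsplit : (cellInterval A U : Set (Cell C v)) =
      cellInterval (A ∪ K) U ∪ cellInterval A (U \ K) := by
    ext σ
    constructor
    · intro hσ
      by_cases h : n₀ ∈ σ.Ω
      · exact Or.inl ⟨Set.union_subset hσ.1 fun n hn => (hK σ hσ n hn).2 h, hσ.2⟩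
      · exact Or.inr ⟨hσ.1, fun n hn => ⟨hσ.2 hn, fun hnK => h ((hK σ hσ n hnK).1 hn)⟩⟩
    · rintro (h | h)
      · exact ⟨Set.subset_union_left.trans h.1, h.2⟩
      · exact ⟨h.1, h.2.trans Set.sdiff_subset⟩
  -- Time `r` comes just after the first crossing, so its point serves for the cells off the walls
  -- in `K`. The crossing point itself serves for the cells on them.
  obtain ⟨r, hr⟩ : ∃ r : ℝ, s n₀ < r ∧ r < 1 ∧ ∀ n, n ∈ U \ A → n ∉ K → r < s n := by
    have h : ∀ᶠ r : ℝ in 𝓝[>] (s n₀), ∀ n, n ∈ U \ A → n ∉ K → r < s n := by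
      rw [eventually_all]
      intro n
      by_cases hn : n ∈ U \ A ∧ n ∉ K
      · have hlt : s n₀ < s n := lt_of_le_of_ne (hmin n hn.1) fun h => hn.2 ⟨hn.1, h.symm⟩
        filter_upwards [mem_nhdsWithin_of_mem_nhds (Iio_mem_nhds hlt)] with r hr _ _ using hr
      · exact Eventually.of_forall fun r h1 h2 => absurd ⟨h1, h2⟩ hn
    have h' : ∀ᶠ r : ℝ in 𝓝[>] (s n₀), r < 1 :=
      mem_nhdsWithin_of_mem_nhds (Iio_mem_nhds (hs1 n₀ hn₀))
    obtain ⟨r, h1, h2, h3⟩ := (h.and (h'.and self_mem_nhdsWithin)).exists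
    exact ⟨r, h3, h2, h1⟩
  have hr0 : 0 < r := (hs0 n₀ hn₀).trans hr.1
  have hAK' : A ∪ K ⊆ U := Set.union_subset hAU hKU
  refine ExactOn.union hsplit (fun τ' hτ' τ hτ => ?_) ?_ ?_
  · by_contra hi
    exact (hτ.2 ((incidence_ne_zero hi).1 (hτ'.1 (Or.inr hn₀K)))).2 hn₀K
  · refine ih _ (Set.ncard_lt_ncard ⟨fun n hn => ⟨hn.1, fun h => hn.2 (Or.inl h)⟩, fun h =>
      (h hn₀).2 (Or.inr hn₀K)⟩ (Set.toFinite _)) (A ∪ K) U hAK' hAK (w + r • (y - w)) ?_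
      (hconvU r) ?_ rfl
    · rintro n (hn | hn)
      · exact hconv r hr0 hr.2.1 n hn
      · exact ⟨hlow r hr0 hr.2.1 n hn.1, hafter r n hn.1 (by rw [hn.2]; exact hr.1)⟩
    · rintro n ⟨hnU, hn⟩
      have hnJ : n ∈ U \ A := ⟨hnU, fun h => hn (Or.inl h)⟩
      exact hbefore r n hnJ (hr.2.2 n hnJ fun h => hn (Or.inr h))
  · refine ih _ (Set.ncard_lt_ncard ⟨fun n hn => ⟨hn.1.1, hn.2⟩, fun h =>
      (h hn₀).1.2 hn₀K⟩ (Set.toFinite _)) A (U \ K) (fun n hn => ⟨hAU hn, fun h => hKA n h hn⟩)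
      ?_ (w + s n₀ • (y - w)) (hconv _ (hs0 n₀ hn₀) (hs1 n₀ hn₀)) ?_ ?_ rfl
    · intro h
      refine hAK (hAK'.antisymm fun n hn => ?_)
      by_cases hnK : n ∈ K
      · exact Or.inr hnK
      · exact Or.inl (h ▸ ⟨hn, hnK⟩)
    · intro n hn
      by_cases hnK : n ∈ K
      · exact hat n hnK
      · exact hconvU _ n fun h => hn ⟨h, hnK⟩
    · rintro n ⟨⟨hnU, hnK⟩, hnA⟩
      exact hbefore _ n ⟨hnU, hnA⟩ (lt_of_le_of_ne (hmin n ⟨hnU, hnA⟩)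
        fun h => hnK ⟨⟨hnU, hnA⟩, h.symm⟩)

end CellComplex

/-! ### Monomial description of modules and homomorphisms -/

section ModuleHom

variable {k : Type*} [Field k] {C : ToricCone L} {v v' : E}

/-- Multiplication by an element of the Laurent ring, between submodules. -/
def mulHom (F : AddMonoidAlgebra k L) (A B : Submodule (toricAlgebra k C) (AddMonoidAlgebra k L))
    (h : ∀ a ∈ A, F * a ∈ B) : A →ₗ[toricAlgebra k C] B where
  toFun a := ⟨F * a, h a a.2⟩
  map_add' a b := Subtype.ext (mul_add F a b)
  map_smul' r a := Subtype.ext (mul_left_comm F (r : AddMonoidAlgebra k L) a)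

theorem coe_smul_eq_mul {B : Submodule (toricAlgebra k C) (AddMonoidAlgebra k L)}
    (r : toricAlgebra k C) (b : B) :
    ((r • b : B) : AddMonoidAlgebra k L) = (r : AddMonoidAlgebra k L) * b := rfl

theorem ceil_add_lattice (n : C.normals) (m : L) (w : E) :
    ⌈(n : Dual ℝ E) (m + w)⌉ = C.height n m + ⌈(n : Dual ℝ E) w⌉ := by
  rw [map_add, ← C.coe_height, Int.ceil_intCast_add]

variable [FiniteDimensional ℝ E] [DiscreteTopology L] [IsZLattice ℝ L]

theorem mem_toricAlgebra_iff {f : AddMonoidAlgebra k L} :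
    f ∈ toricAlgebra k C ↔ ∀ m ∈ f.coeff.support, ∀ n, 0 ≤ C.height n m := by
  refine forall₂_congr fun m _ => ?_
  rw [C.mem_cone_iff, Subtype.forall']
  refine forall_congr' fun n => ?_
  rw [← C.coe_height]
  exact_mod_cast Iff.rfl

/-- Heights are integers, so only the ceilings of the values at `w` matter. -/
theorem sub_mem_cone_iff (m : L) (w : E) :
    (m : E) - w ∈ C.cone ↔ ∀ n : C.normals, ⌈(n : Dual ℝ E) w⌉ ≤ C.height n m := by
  rw [C.mem_cone_iff, Subtype.forall']
  refine forall_congr' fun n => ?_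
  rw [map_sub, sub_nonneg, ← C.coe_height, Int.ceil_le]

theorem mem_conicModule_iff {f : AddMonoidAlgebra k L} :
    f ∈ conicModule k C v ↔
      ∀ m ∈ f.coeff.support, ∀ n : C.normals, ⌈(n : Dual ℝ E) v⌉ ≤ C.height n m :=
  forall₂_congr fun m _ => sub_mem_cone_iff m v

open Classical in
/-- The least height over a facet of the degrees occurring in `Å_τ`. -/
def Cell.bound (τ : Cell C v) (n : C.normals) : ℤ :=
  ⌈(n : Dual ℝ E) v⌉ + if n ∈ τ.Ω then 0 else 1

/-- Strict positivity asks an integer height to exceed the value on the cell: at least `d_n` if that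
value is strictly between `d_n - 1` and `d_n`, at least `d_n + 1` if it equals `d_n`. -/
theorem Cell.mem_openModule_iff {τ : Cell C v} {f : AddMonoidAlgebra k L} :
    f ∈ τ.openModule k ↔ ∀ m ∈ f.coeff.support, ∀ n, τ.bound n ≤ C.height n m := by
  refine forall₂_congr fun m _ => ?_
  change (m : E) - τ.point ∈ interior (C.cone : Set E) ↔ _
  rw [C.mem_interior_iff]
  refine forall_congr' fun n => ?_
  rw [map_sub, sub_pos, ← C.coe_height, Cell.bound]
  have hτ := τ.point_mem
  by_cases hn : n ∈ τ.Ω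
  · rw [if_pos hn, add_zero]
    have h := hτ.1 n hn
    constructor
    · intro h'
      have : (⌈(n : Dual ℝ E) v⌉ : ℝ) < C.height n m + 1 := by linarith
      have : ⌈(n : Dual ℝ E) v⌉ < C.height n m + 1 := by exact_mod_cast this
      omega
    · intro h'
      have : (⌈(n : Dual ℝ E) v⌉ : ℝ) ≤ C.height n m := by exact_mod_cast h'
      linarith
  · rw [if_neg hn, hτ.2 n hn, Int.add_one_le_iff]
    exact_mod_cast Iff.rfl

theorem single_mem_conicModule {p : L} (hp : ∀ n : C.normals, ⌈(n : Dual ℝ E) v⌉ ≤ C.height n p)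
    (c : k) : AddMonoidAlgebra.single p c ∈ conicModule k C v := by
  rw [mem_conicModule_iff]
  intro m hm
  rw [Finset.mem_singleton.1 (Finsupp.support_single_subset hm)]
  exact hp

theorem Cell.openModule_le_iff {τ' τ : Cell C v} :
    τ'.openModule k ≤ τ.openModule k ↔ τ'.Ω ⊆ τ.Ω := by
  constructor
  · intro h n hn
    -- A monomial attaining the bound over `n` detects any larger bound in the other module.
    obtain ⟨m, hm, hm'⟩ := C.exists_height_eq n τ'.bound
    have h1 : AddMonoidAlgebra.single m (1 : k) ∈ τ'.openModule k := by
      rw [mem_openModule_iff]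
      intro p hp
      rw [Finset.mem_singleton.1 (Finsupp.support_single_subset hp)]
      exact hm'
    have h2 := mem_openModule_iff.1 (h h1) m (by simp) n
    by_contra hn'
    rw [hm, bound, bound, if_pos hn, if_neg hn'] at h2
    omega
  · intro h f hf
    rw [mem_openModule_iff] at hf ⊢
    intro m hm n
    refine le_trans ?_ (hf m hm n)
    unfold bound
    have := @h n
    split_ifs <;> first | omega | tauto

/-- Homomorphisms from conic modules to submodules of the Laurent ring are multiplications. -/
theorem exists_mul_of_hom {B : Submodule (toricAlgebra k C) (AddMonoidAlgebra k L)}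
    (φ : conicModule k C v →ₗ[toricAlgebra k C] B) :
    ∃ F : AddMonoidAlgebra k L, ∀ a, (φ a : AddMonoidAlgebra k L) = F * a := by
  obtain ⟨p, hp⟩ := C.exists_le_height fun n => ⌈(n : Dual ℝ E) v⌉
  let x : conicModule k C v := ⟨AddMonoidAlgebra.single p 1, single_mem_conicModule hp 1⟩
  refine ⟨AddMonoidAlgebra.single (-p) (1 : k) * (φ x : AddMonoidAlgebra k L), fun a => ?_⟩
  -- For `r` this high both `x^r` and `x^(r-p) * a` lie in `R`. The identity `x^r • a = (x^(r-p) *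
  -- a) • x^p` then determines `φ a` from `φ (x^p)`.
  obtain ⟨r, hr⟩ := C.exists_le_height fun n =>
    max 0 (C.height n p - ⌈(n : Dual ℝ E) v⌉)
  let β : toricAlgebra k C := ⟨AddMonoidAlgebra.single r 1, by
    rw [mem_toricAlgebra_iff]
    intro m hm n
    rw [Finset.mem_singleton.1 (Finsupp.support_single_subset hm)]
    exact (le_max_left _ _).trans (hr n)⟩
  let α : toricAlgebra k C := ⟨AddMonoidAlgebra.single (r - p) (1 : k) * (a : AddMonoidAlgebra k L), by
    classical
    rw [mem_toricAlgebra_iff]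
    intro m hm n
    obtain ⟨q, hq, s, hs, rfl⟩ :=
      Finset.mem_add.1 (AddMonoidAlgebra.support_coeff_mul_subset _ _ hm)
    rw [Finset.mem_singleton.1 (Finsupp.support_single_subset hq), C.height_add, C.height_sub]
    have h1 := (le_max_right _ _).trans (hr n)
    have h2 := mem_conicModule_iff.1 a.2 s hs n
    omega⟩
  have hαβ : β • a = α • x := by
    refine Subtype.ext ?_
    rw [coe_smul_eq_mul, coe_smul_eq_mul]
    change AddMonoidAlgebra.single r 1 * (a : AddMonoidAlgebra k L) =
      AddMonoidAlgebra.single (r - p) 1 * (a : AddMonoidAlgebra k L) * AddMonoidAlgebra.single p 1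
    rw [mul_right_comm, AddMonoidAlgebra.single_mul_single, sub_add_cancel, one_mul]
  have h := congrArg (fun b => (φ b : AddMonoidAlgebra k L)) hαβ
  simp only [map_smul, coe_smul_eq_mul] at h
  change AddMonoidAlgebra.single r 1 * (φ a : AddMonoidAlgebra k L) =
    AddMonoidAlgebra.single (r - p) 1 * (a : AddMonoidAlgebra k L) *
      (φ x : AddMonoidAlgebra k L) at h
  have h' := congrArg (fun b => AddMonoidAlgebra.single (-r) (1 : k) * b) h
  simp only [← mul_assoc, AddMonoidAlgebra.single_mul_single, one_mul, neg_add_cancel] at h'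
  rw [← AddMonoidAlgebra.one_def, one_mul] at h'
  rw [h', mul_right_comm]
  congr 3
  abel

/-- The degrees of the homogeneous homomorphisms from a conic module to a monomial module. -/
theorem bound_le_of_forall_mul {F : AddMonoidAlgebra k L} {b : C.normals → ℤ}
    (hF : ∀ a ∈ conicModule k C v, ∀ m ∈ (F * a).coeff.support, ∀ n, b n ≤ C.height n m) {m : L}
    (hm : m ∈ F.coeff.support) (n : C.normals) :
    b n ≤ C.height n m + ⌈(n : Dual ℝ E) v⌉ := by
  -- The test monomial has the least possible height over `n`, which makes the inequality sharp.
  obtain ⟨p, hp, hp'⟩ := C.exists_height_eq n fun n => ⌈(n : Dual ℝ E) v⌉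
  have h := hF _ (single_mem_conicModule hp' (1 : k)) (m + p) (by
    rw [Finsupp.mem_support_iff, AddMonoidAlgebra.coeff_mul_single_add, mul_one]
    exact Finsupp.mem_support_iff.1 hm) n
  rwa [C.height_add, hp] at h

theorem bound_le_mul {F : AddMonoidAlgebra k L} {b : C.normals → ℤ}
    (hF : ∀ m ∈ F.coeff.support, ∀ n, b n ≤ C.height n m + ⌈(n : Dual ℝ E) v⌉)
    {a : AddMonoidAlgebra k L} (ha : a ∈ conicModule k C v) {m : L}
    (hm : m ∈ (F * a).coeff.support) (n : C.normals) : b n ≤ C.height n m := by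
  classical
  obtain ⟨q, hq, s, hs, rfl⟩ :=
    Finset.mem_add.1 (AddMonoidAlgebra.support_coeff_mul_subset _ _ hm)
  have h1 := hF q hq n
  have h2 := mem_conicModule_iff.1 ha s hs n
  rw [C.height_add]
  omega

variable (C v v') in
/-- The degrees of the isomorphisms between the conic modules of `v'` and `v`. -/
def IsShift (m : L) : Prop :=
  ∀ n : C.normals, ⌈(n : Dual ℝ E) v⌉ = C.height n m + ⌈(n : Dual ℝ E) v'⌉

theorem IsShift.eq {m m' : L} (h : IsShift C v v' m) (h' : IsShift C v v' m') : m' = m := by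
  refine sub_eq_zero.1 (Subtype.ext (C.eq_zero_of_normals fun n => ?_))
  rw [← C.coe_height, C.height_sub]
  have h1 := h n
  have h2 := h' n
  rw [show C.height n m' - C.height n m = 0 by omega, Int.cast_zero]

/-- An isomorphism and its inverse are multiplications by `G` and `F` with `F * G = 1`. The constant
term gives opposite degrees `m`, `-m` in their supports, and the bounds for both directions combine
to equalities. The units of the Laurent ring need not be known. -/
theorem nonempty_equiv_iff_exists_isShift :
    Nonempty (conicModule k C v ≃ₗ[toricAlgebra k C] conicModule k C v') ↔
      ∃ m, IsShift C v v' m := by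
  classical
  constructor
  · rintro ⟨e⟩
    obtain ⟨G, hG⟩ := exists_mul_of_hom e.toLinearMap
    obtain ⟨F, hF⟩ := exists_mul_of_hom e.symm.toLinearMap
    have hGmem : ∀ a ∈ conicModule k C v, G * a ∈ conicModule k C v' := fun a ha => by
      rw [← hG ⟨a, ha⟩]
      exact Subtype.coe_prop _
    have hFmem : ∀ a ∈ conicModule k C v', F * a ∈ conicModule k C v := fun a ha => by
      rw [← hF ⟨a, ha⟩]
      exact Subtype.coe_prop _
    obtain ⟨p, hp⟩ := C.exists_le_height fun n => ⌈(n : Dual ℝ E) v⌉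
    have hone : F * G = 1 := by
      have h := hF (e ⟨_, single_mem_conicModule hp (1 : k)⟩)
      have h' := hG ⟨_, single_mem_conicModule hp (1 : k)⟩
      simp only [LinearEquiv.coe_coe, LinearEquiv.symm_apply_apply] at h h'
      rw [h', ← mul_assoc] at h
      have h2 := congrArg (fun b => b * AddMonoidAlgebra.single (-p) (1 : k)) h
      simp only [mul_assoc, AddMonoidAlgebra.single_mul_single, one_mul, add_neg_cancel] at h2
      rw [← AddMonoidAlgebra.one_def, mul_one] at h2
      exact h2.symm
    have h0 : (0 : L) ∈ (F * G).coeff.support := by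
      rw [hone, AddMonoidAlgebra.one_def]
      simp
    obtain ⟨m, hm, m', hm', hmm⟩ :=
      Finset.mem_add.1 (AddMonoidAlgebra.support_coeff_mul_subset _ _ h0)
    refine ⟨m, fun n => ?_⟩
    have h1 := bound_le_of_forall_mul (fun a ha => mem_conicModule_iff.1 (hFmem a ha)) hm n
    have h2 := bound_le_of_forall_mul (fun a ha => mem_conicModule_iff.1 (hGmem a ha)) hm' n
    have h3 := C.height_add n m m'
    rw [hmm, C.height_zero] at h3
    omega
  · rintro ⟨m, hm⟩
    have h1 : ∀ a ∈ conicModule k C v, AddMonoidAlgebra.single (-m) 1 * a ∈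
        conicModule k C v' := fun a ha => by
      refine mem_conicModule_iff.2 fun q hq n => bound_le_mul
        (b := fun n => ⌈(n : Dual ℝ E) v'⌉) (fun s hs n => ?_) ha hq n
      rw [Finset.mem_singleton.1 (Finsupp.support_single_subset hs)]
      have h3 := C.height_add n m (-m)
      rw [add_neg_cancel, C.height_zero] at h3
      have := hm n
      omega
    have h2 : ∀ a ∈ conicModule k C v', AddMonoidAlgebra.single m 1 * a ∈
        conicModule k C v := fun a ha => by
      refine mem_conicModule_iff.2 fun q hq n => bound_le_mul
        (b := fun n => ⌈(n : Dual ℝ E) v⌉) (fun s hs n => ?_) ha hq n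
      rw [Finset.mem_singleton.1 (Finsupp.support_single_subset hs)]
      exact (hm n).le
    refine ⟨LinearEquiv.ofLinearMap (mulHom _ _ _ h1) (mulHom _ _ _ h2) ?_ ?_⟩
    · refine LinearMap.ext fun a => Subtype.ext ?_
      change AddMonoidAlgebra.single (-m) (1 : k) *
        (AddMonoidAlgebra.single m 1 * (a : AddMonoidAlgebra k L)) = (a : AddMonoidAlgebra k L)
      rw [← mul_assoc, AddMonoidAlgebra.single_mul_single, neg_add_cancel, one_mul,
        ← AddMonoidAlgebra.one_def, one_mul]
    · refine LinearMap.ext fun a => Subtype.ext ?_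
      change AddMonoidAlgebra.single m (1 : k) *
        (AddMonoidAlgebra.single (-m) 1 * (a : AddMonoidAlgebra k L)) = (a : AddMonoidAlgebra k L)
      rw [← mul_assoc, AddMonoidAlgebra.single_mul_single, add_neg_cancel, one_mul,
        ← AddMonoidAlgebra.one_def, one_mul]

/-- The ceiling at `n` is the least height over `n` in the module, and it is attained; so the
lattice points determine the ceilings. -/
theorem mem_chamber_iff {w : E} :
    w ∈ chamber C v ↔ ∀ n : C.normals, ⌈(n : Dual ℝ E) w⌉ = ⌈(n : Dual ℝ E) v⌉ := by
  have hiff : w ∈ chamber C v ↔ ∀ m : L, (∀ n : C.normals, ⌈(n : Dual ℝ E) w⌉ ≤ C.height n m) ↔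
      ∀ n : C.normals, ⌈(n : Dual ℝ E) v⌉ ≤ C.height n m := by
    simp only [← sub_mem_cone_iff]
    exact ⟨fun h m => h m m.2, fun h m hm => h ⟨m, hm⟩⟩
  rw [hiff]
  constructor
  · intro h n
    refine le_antisymm ?_ ?_
    · obtain ⟨m, hm, hm'⟩ := C.exists_height_eq n fun n => ⌈(n : Dual ℝ E) v⌉
      exact hm ▸ (h m).2 hm' n
    · obtain ⟨m, hm, hm'⟩ := C.exists_height_eq n fun n => ⌈(n : Dual ℝ E) w⌉
      exact hm ▸ (h m).1 hm' n
  · intro h m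
    simp only [h]

theorem chamber_eq_image_iff (m : L) :
    chamber C v = (fun x => (m : E) + x) '' chamber C v' ↔ IsShift C v v' m := by
  constructor
  · intro h n
    have hv : v ∈ chamber C v := mem_chamber_iff.2 fun _ => rfl
    rw [h] at hv
    obtain ⟨x, hx, hxv⟩ := hv
    conv_lhs => rw [← hxv]
    rw [ceil_add_lattice, mem_chamber_iff.1 hx]
  · intro h
    ext x
    constructor
    · intro hx
      refine ⟨x - m, mem_chamber_iff.2 fun n => ?_, by simp⟩
      have h1 := ceil_add_lattice n m (x - m)
      rw [add_sub_cancel, mem_chamber_iff.1 hx, h n] at h1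
      omega
    · rintro ⟨y, hy, rfl⟩
      refine mem_chamber_iff.2 fun n => ?_
      rw [ceil_add_lattice, mem_chamber_iff.1 hy, h n]

end ModuleHom

/-! ### The strands of the Hom complex and their exactness -/

section HomComplex

open Filter Topology

variable {k : Type*} [Field k] {C : ToricCone L} {v v' : E}

theorem sum_subtype_codim {G : Type*} [AddCommMonoid G] (j : ℕ) (g : Cell C v → G)
    (hg : ∀ τ, τ.codim ≠ j → g τ = 0) :
    ∑ τ : {τ : Cell C v // τ.codim = j}, g τ = ∑ τ, g τ := by
  classical
  rw [← Finset.sum_subtype (Finset.univ.filter fun τ : Cell C v => τ.codim = j) (by simp) g]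
  exact Finset.sum_subset (Finset.filter_subset _ _) fun τ _ h => hg τ (by simpa using h)

open Classical in
/-- The coefficients in degree `m` of a family of multipliers. -/
def coeffAt {i : ℕ} (F : {τ : Cell C v // τ.codim = i} → AddMonoidAlgebra k L) (m : L)
    (τ : Cell C v) : k :=
  if h : τ.codim = i then (F ⟨τ, h⟩).coeff m else 0

theorem coeffAt_of_codim {i : ℕ} (F : {τ : Cell C v // τ.codim = i} → AddMonoidAlgebra k L)
    (m : L) (τ : {τ : Cell C v // τ.codim = i}) : coeffAt F m τ.1 = (F τ).coeff m :=
  dif_pos τ.2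

/-- In the degree of an isomorphism all inequalities are tight, with no room for the extra one in
`Cell.bound` on a facet. -/
theorem Cell.Ω_eq_univ_of_isShift {τ : Cell C v} {m : L} (hm : IsShift C v v' m)
    (h : ∀ n : C.normals, τ.bound n ≤ C.height n m + ⌈(n : Dual ℝ E) v'⌉) : τ.Ω = Set.univ := by
  refine Set.eq_univ_of_forall fun n => ?_
  by_contra hn
  have h1 := h n
  rw [bound, if_neg hn, ← hm n] at h1
  omega

theorem coeff_sum_incidence_smul (o : CellOrientations C v) {i : ℕ}
    (F : {τ : Cell C v // τ.codim = i + 1} → AddMonoidAlgebra k L)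
    (τ : {τ : Cell C v // τ.codim = i}) (m : L) :
    (∑ τ' : {τ : Cell C v // τ.codim = i + 1}, incidence o τ'.1 τ.1 • F τ').coeff m =
      cellDiff k o (coeffAt F m) τ := by
  rw [cellDiff_apply, ← sum_subtype_codim (i + 1), AddMonoidAlgebra.coeff_sum,
    Finsupp.finsetSum_apply]
  · refine Finset.sum_congr rfl fun τ' _ => ?_
    rw [coeffAt_of_codim, AddMonoidAlgebra.coeff_smul_apply, zsmul_eq_mul]
  · intro τ' h
    rw [coeffAt, dif_neg h, mul_zero]

/-- The point is `m + v'`, moved slightly against an interior direction so that it leaves the closed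
upper walls. When `h_n + d'_n` is not `d_n` it is at least `d_n + 1`, so values above `h_n + d'_n -
1` are beyond the facet. -/
theorem exists_point_beyond [DiscreteTopology L] [IsZLattice ℝ L] (m : L)
    (hm : ∀ n : C.normals, ⌈(n : Dual ℝ E) v⌉ ≤ C.height n m + ⌈(n : Dual ℝ E) v'⌉) :
    ∃ w : E, ∀ n : C.normals,
      (C.height n m + ⌈(n : Dual ℝ E) v'⌉ = ⌈(n : Dual ℝ E) v⌉ →
        (⌈(n : Dual ℝ E) v⌉ : ℝ) - 1 < (n : Dual ℝ E) w ∧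
          (n : Dual ℝ E) w < ⌈(n : Dual ℝ E) v⌉) ∧
      (C.height n m + ⌈(n : Dual ℝ E) v'⌉ ≠ ⌈(n : Dual ℝ E) v⌉ →
        (⌈(n : Dual ℝ E) v⌉ : ℝ) < (n : Dual ℝ E) w) := by
  obtain ⟨c, -, hc⟩ := C.exists_interior_point
  have h : ∀ n : C.normals, ∀ᶠ ε : ℝ in 𝓝[>] 0,
      (C.height n m + ⌈(n : Dual ℝ E) v'⌉ : ℝ) - 1 < (n : Dual ℝ E) ((m + v') - ε • c) ∧
        (n : Dual ℝ E) ((m + v') - ε • c) < (C.height n m + ⌈(n : Dual ℝ E) v'⌉ : ℝ) := by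
    intro n
    have hval : ∀ ε : ℝ, (n : Dual ℝ E) ((m + v') - ε • c) =
        C.height n m + (n : Dual ℝ E) v' - ε * (n : Dual ℝ E) c := fun ε => by
      rw [map_sub, map_smul, map_add, ← C.coe_height, smul_eq_mul]
    have hlim : Tendsto (fun ε : ℝ => C.height n m + (n : Dual ℝ E) v' - ε * (n : Dual ℝ E) c)
        (𝓝[>] 0) (𝓝 (C.height n m + (n : Dual ℝ E) v' - 0 * (n : Dual ℝ E) c)) :=
      tendsto_nhdsWithin_of_tendsto_nhds (Continuous.tendsto (by fun_prop) 0)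
    have h1 := Int.ceil_lt_add_one ((n : Dual ℝ E) v')
    have h2 := Int.le_ceil ((n : Dual ℝ E) v')
    filter_upwards [hlim.eventually_const_lt (u := (C.height n m + ⌈(n : Dual ℝ E) v'⌉ - 1 : ℝ))
      (by linarith), self_mem_nhdsWithin] with ε h3 h4
    rw [hval]
    have := mul_pos (show 0 < ε from h4) (hc n)
    exact ⟨h3, by linarith⟩
  obtain ⟨ε, hε⟩ := (eventually_all.2 h).exists
  refine ⟨m + v' - ε • c, fun n => ⟨fun heq => ?_, fun hne => ?_⟩⟩
  · have := hε n
    rw [← heq]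
    push_cast
    exact this
  · have h1 : ⌈(n : Dual ℝ E) v⌉ + 1 ≤ C.height n m + ⌈(n : Dual ℝ E) v'⌉ := by
      have := hm n
      omega
    have h2 : (⌈(n : Dual ℝ E) v⌉ : ℝ) + 1 ≤ C.height n m + ⌈(n : Dual ℝ E) v'⌉ := by
      exact_mod_cast h1
    linarith [(hε n).1]

/-- For `m = 0` and `v' = v` every normal is in the case of equality, so the point found lies
strictly inside all walls. -/
theorem exists_cell_univ [DiscreteTopology L] [IsZLattice ℝ L] : ∃ τ : Cell C v, τ.Ω = Set.univ := by
  obtain ⟨w, hw⟩ := exists_point_beyond (C := C) (v := v) (v' := v) 0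
    fun n => by rw [C.height_zero, zero_add]
  refine ⟨⟨Set.univ, w, fun n _ => (hw n).1 (by rw [C.height_zero, zero_add]), fun n hn =>
    absurd (Set.mem_univ n) hn⟩, rfl⟩

theorem subsingleton_homHomology (o : CellOrientations C v) {i : ℕ}
    (h : ∀ φ ∈ homCycles k o v' i, φ ∈ homBoundaries k o v' i) :
    Subsingleton (homHomology k o v' i) :=
  Submodule.Quotient.subsingleton_iff.2 (eq_top_iff.2 fun φ _ => h φ φ.2)

variable [FiniteDimensional ℝ E] [DiscreteTopology L] [IsZLattice ℝ L]

theorem coe_chainComponent (o : CellOrientations C v) {τ' τ : Cell C v}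
    (h : τ'.codim = τ.codim + 1) (a : τ'.openModule k) :
    (chainComponent k o τ' τ a : AddMonoidAlgebra k L) =
      incidence o τ' τ • (a : AddMonoidAlgebra k L) := by
  unfold chainComponent
  split_ifs with hle
  · rw [incidence_of_pos ⟨Cell.openModule_le_iff.1 hle, h⟩]
    rfl
  · have : incidence o τ' τ = 0 := by
      by_contra h0
      exact hle (Cell.openModule_le_iff.2 (incidence_ne_zero h0).1)
    rw [this, zero_smul]
    rfl

theorem coe_chainDiff (o : CellOrientations C v) (i : ℕ) (f : chainTerm k C v (i + 1))
    (τ : {τ : Cell C v // τ.codim = i}) :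
    (chainDiff k o i f τ : AddMonoidAlgebra k L) =
      ∑ τ' : {τ : Cell C v // τ.codim = i + 1},
        incidence o τ'.1 τ.1 • (f τ' : AddMonoidAlgebra k L) := by
  change ((∑ τ' : {τ : Cell C v // τ.codim = i + 1},
    chainComponent k o τ'.1 τ.1 (f τ') : τ.1.openModule k) : AddMonoidAlgebra k L) = _
  rw [Submodule.coe_sum]
  exact Finset.sum_congr rfl fun τ' _ => coe_chainComponent o (by rw [τ'.2, τ.2]) _

theorem chainDiff_comp_chainDiff (o : CellOrientations C v) (i : ℕ) :
    chainDiff k o i ∘ₗ chainDiff k o (i + 1) = 0 := by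
  refine LinearMap.ext fun f => funext fun τ => Subtype.ext ?_
  rw [LinearMap.comp_apply, coe_chainDiff]
  simp only [coe_chainDiff, Finset.smul_sum, smul_smul]
  rw [Finset.sum_comm]
  refine Finset.sum_eq_zero fun τ'' _ => ?_
  rw [← Finset.sum_smul, sum_subtype_codim (i + 1)
    (fun τ' => incidence o τ' τ.1 * incidence o τ''.1 τ')]
  · simp only [mul_comm (incidence o _ τ.1), sum_incidence_mul_incidence, zero_smul]
  · intro τ' h
    by_contra h0
    have := (incidence_ne_zero (left_ne_zero_of_mul h0)).2
    have := τ.2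
    omega

/-- Homomorphisms from a conic module to a term of the complex, by their multipliers. -/
def multHom (i : ℕ) (F : {τ : Cell C v // τ.codim = i} → AddMonoidAlgebra k L)
    (hF : ∀ τ, ∀ m ∈ (F τ).coeff.support, ∀ n : C.normals,
      τ.1.bound n ≤ C.height n m + ⌈(n : Dual ℝ E) v'⌉) : homTerm k C v v' i :=
  LinearMap.pi fun τ => mulHom (F τ) (conicModule k C v') (τ.1.openModule k) fun _ ha =>
    Cell.mem_openModule_iff.2 fun _ hq n => bound_le_mul (hF τ) ha hq n

theorem coe_multHom {i : ℕ} (F : {τ : Cell C v // τ.codim = i} → AddMonoidAlgebra k L)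
    (hF : ∀ τ, ∀ m ∈ (F τ).coeff.support, ∀ n : C.normals,
      τ.1.bound n ≤ C.height n m + ⌈(n : Dual ℝ E) v'⌉)
    (a : conicModule k C v') (τ : {τ : Cell C v // τ.codim = i}) :
    (multHom i F hF a τ : AddMonoidAlgebra k L) = F τ * (a : AddMonoidAlgebra k L) := rfl

theorem exists_multipliers {i : ℕ} (φ : homTerm k C v v' i) :
    ∃ F : {τ : Cell C v // τ.codim = i} → AddMonoidAlgebra k L,
      (∀ τ, ∀ m ∈ (F τ).coeff.support, ∀ n : C.normals,
        τ.1.bound n ≤ C.height n m + ⌈(n : Dual ℝ E) v'⌉) ∧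
      ∀ a τ, (φ a τ : AddMonoidAlgebra k L) = F τ * (a : AddMonoidAlgebra k L) := by
  have h : ∀ τ, ∃ F : AddMonoidAlgebra k L, ∀ a,
      (φ a τ : AddMonoidAlgebra k L) = F * (a : AddMonoidAlgebra k L) := fun τ =>
    exists_mul_of_hom (LinearMap.proj τ ∘ₗ φ)
  choose F hF using h
  refine ⟨F, fun τ m hm n => ?_, fun a τ => hF τ a⟩
  refine bound_le_of_forall_mul (b := τ.1.bound) (fun a ha => ?_) hm n
  rw [← hF τ ⟨a, ha⟩]
  exact Cell.mem_openModule_iff.1 (Subtype.coe_prop _)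

variable (k C v') in
/-- A monomial in a conic module. -/
theorem exists_single_mem_conicModule : ∃ p : L, AddMonoidAlgebra.single p (1 : k) ∈
    conicModule k C v' :=
  (C.exists_le_height fun n => ⌈(n : Dual ℝ E) v'⌉).imp fun _ hp => single_mem_conicModule hp 1

theorem eq_of_forall_mul_eq {F G : AddMonoidAlgebra k L}
    (h : ∀ a ∈ conicModule k C v', F * a = G * a) : F = G := by
  obtain ⟨p, hp⟩ := exists_single_mem_conicModule k C v'
  have h1 := congrArg (fun b => b * AddMonoidAlgebra.single (-p) (1 : k)) (h _ hp)
  simpa only [mul_assoc, AddMonoidAlgebra.single_mul_single, one_mul, add_neg_cancel,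
    ← AddMonoidAlgebra.one_def, mul_one] using h1

theorem coe_homDiff (o : CellOrientations C v) {i : ℕ} {φ : homTerm k C v v' (i + 1)}
    {F : {τ : Cell C v // τ.codim = i + 1} → AddMonoidAlgebra k L}
    (hF : ∀ a τ, (φ a τ : AddMonoidAlgebra k L) = F τ * (a : AddMonoidAlgebra k L))
    (a : conicModule k C v') (τ : {τ : Cell C v // τ.codim = i}) :
    (homDiff k o v' i φ a τ : AddMonoidAlgebra k L) =
      (∑ τ' : {τ : Cell C v // τ.codim = i + 1}, incidence o τ'.1 τ.1 • F τ') *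
        (a : AddMonoidAlgebra k L) := by
  change (chainDiff k o i (φ a) τ : AddMonoidAlgebra k L) = _
  rw [coe_chainDiff, Finset.sum_mul]
  exact Finset.sum_congr rfl fun τ' _ => by rw [hF, smul_mul_assoc]

/-- Only cells of codimension `i - 1` give a condition, which is the cycle condition read in degree
`m`. For `i = 0` there are none, in accordance with all elements being cycles. -/
theorem cellDiff_coeffAt_of_mem_homCycles (o : CellOrientations C v) {i : ℕ}
    {φ : homTerm k C v v' i} (hφ : φ ∈ homCycles k o v' i)
    {F : {τ : Cell C v // τ.codim = i} → AddMonoidAlgebra k L}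
    (hF : ∀ a τ, (φ a τ : AddMonoidAlgebra k L) = F τ * (a : AddMonoidAlgebra k L)) (m : L) :
    cellDiff k o (coeffAt F m) = 0 := by
  funext τ
  by_cases hi : i = τ.codim + 1
  · subst hi
    have h0 : homDiff k o v' τ.codim φ = 0 := hφ
    have h1 := coeff_sum_incidence_smul o F ⟨τ, rfl⟩ m
    have h2 : ∑ τ' : {τ' : Cell C v // τ'.codim = τ.codim + 1},
        incidence o τ'.1 τ • F τ' = 0 := by
      refine eq_of_forall_mul_eq (C := C) (v' := v') fun a ha => ?_
      rw [← coe_homDiff o hF ⟨a, ha⟩ ⟨τ, rfl⟩, h0, zero_mul]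
      rfl
    rw [Pi.zero_apply, ← h1, h2]
    rfl
  · refine cellDiff_eq_zero_of fun τ' hτ' => ?_
    by_contra h
    have h1 := (incidence_ne_zero h).2
    refine hτ' (dif_neg ?_)
    omega

/-- Exactness of the part of degree `m` of the complex of homomorphisms, unless `m` is the degree
of an isomorphism. -/
theorem exists_cellDiff_eq (o : CellOrientations C v) {m : L} (hm : ¬ IsShift C v v' m)
    {f : Cell C v → k} (hf : ∀ τ, f τ ≠ 0 → ∀ n : C.normals,
      τ.bound n ≤ C.height n m + ⌈(n : Dual ℝ E) v'⌉) (hcyc : cellDiff k o f = 0) :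
    ∃ g : Cell C v → k, (∀ τ, g τ ≠ 0 → ∀ n : C.normals,
      τ.bound n ≤ C.height n m + ⌈(n : Dual ℝ E) v'⌉) ∧ cellDiff k o g = f := by
  by_cases hle : ∀ n : C.normals, ⌈(n : Dual ℝ E) v⌉ ≤ C.height n m + ⌈(n : Dual ℝ E) v'⌉
  swap
  · refine ⟨0, fun τ h => absurd rfl h, ?_⟩
    rw [map_zero]
    funext τ
    by_contra h
    refine hle fun n => le_trans ?_ (hf τ (Ne.symm h) n)
    unfold Cell.bound
    split_ifs <;> omega
  -- The tight normals: the cells of the strand are those whose `Ω` contains `A`. That `m` is not a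
  -- shift says that `A` is proper.
  let A : Set C.normals := {n | C.height n m + ⌈(n : Dual ℝ E) v'⌉ = ⌈(n : Dual ℝ E) v⌉}
  have hsupp : ∀ τ : Cell C v, τ ∈ cellInterval A Set.univ ↔
      ∀ n : C.normals, τ.bound n ≤ C.height n m + ⌈(n : Dual ℝ E) v'⌉ := by
    intro τ
    constructor
    · intro hτ n
      have h1 := hle n
      unfold Cell.bound
      split_ifs with hn
      · omega
      · have : ¬ C.height n m + ⌈(n : Dual ℝ E) v'⌉ = ⌈(n : Dual ℝ E) v⌉ := fun h =>
          hn (hτ.1 h)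
        omega
    · intro h
      refine ⟨fun n hn => ?_, Set.subset_univ _⟩
      by_contra hn'
      have h1 := h n
      rw [Cell.bound, if_neg hn', show C.height n m + ⌈(n : Dual ℝ E) v'⌉ = _ from hn] at h1
      omega
  obtain ⟨w, hw⟩ := exists_point_beyond m hle
  obtain ⟨g, hg, hd⟩ := exactOn_cellInterval (k := k) o A Set.univ (Set.subset_univ _)
    (fun h => hm fun n => by
      have : n ∈ A := h ▸ Set.mem_univ n
      exact this.symm) w (fun n hn => (hw n).1 hn) (fun n hn => absurd (Set.mem_univ n) hn)
    (fun n hn => (hw n).2 hn.2) f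
    (fun τ hτ => by
      by_contra h
      exact hτ ((hsupp τ).2 (hf τ h)))
    (fun τ _ => congrFun hcyc τ)
  have hg' : ∀ τ, g τ ≠ 0 → τ ∈ cellInterval A Set.univ := fun τ h => by
    by_contra h'
    exact h (hg τ h')
  refine ⟨g, fun τ h => (hsupp τ).1 (hg' τ h), funext fun τ => ?_⟩
  by_cases hτ : τ ∈ cellInterval A Set.univ
  · exact hd τ hτ
  · have hfτ : f τ = 0 := by
      by_contra h
      exact hτ ((hsupp τ).2 (hf τ h))
    rw [hfτ]
    refine cellDiff_eq_zero_of fun τ' h => ?_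
    by_contra hi
    exact hτ ⟨(hg' τ' h).1.trans (incidence_ne_zero hi).1, Set.subset_univ _⟩

/-- Exactness is applied in each degree separately, and the primitives are collected into Laurent
polynomials. Degrees of isomorphisms are excluded by `hshift`, where zero serves as primitive. -/
theorem mem_homBoundaries_of_cycle (o : CellOrientations C v) {i : ℕ} {φ : homTerm k C v v' i}
    (hφ : φ ∈ homCycles k o v' i)
    {F : {τ : Cell C v // τ.codim = i} → AddMonoidAlgebra k L}
    (hFsupp : ∀ τ, ∀ m ∈ (F τ).coeff.support, ∀ n : C.normals,
        τ.1.bound n ≤ C.height n m + ⌈(n : Dual ℝ E) v'⌉)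
    (hF : ∀ a τ, (φ a τ : AddMonoidAlgebra k L) = F τ * (a : AddMonoidAlgebra k L))
    (hshift : ∀ m, IsShift C v v' m → ∀ τ, (F τ).coeff m = 0) :
    φ ∈ homBoundaries k o v' i := by
  classical
  have hex : ∀ m : L, ∃ g : Cell C v → k, (∀ τ, g τ ≠ 0 → ∀ n : C.normals,
      τ.bound n ≤ C.height n m + ⌈(n : Dual ℝ E) v'⌉) ∧ cellDiff k o g = coeffAt F m := by
    intro m
    by_cases hm : IsShift C v v' m
    · refine ⟨0, fun τ h => absurd rfl h, ?_⟩
      rw [map_zero]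
      funext τ
      unfold coeffAt
      split_ifs with h
      · rw [hshift m hm]
        rfl
      · rfl
    · refine exists_cellDiff_eq o hm (fun τ hτ => ?_) (cellDiff_coeffAt_of_mem_homCycles o hφ hF m)
      unfold coeffAt at hτ
      split_ifs at hτ with h
      · exact hFsupp ⟨τ, h⟩ m (Finsupp.mem_support_iff.2 hτ)
      · exact absurd rfl hτ
  choose g hg hgd using hex
  let s : Finset L := Finset.univ.biUnion fun τ => (F τ).coeff.support
  -- Restricting the sum to the finite set `s` of occurring degrees makes `G` a Laurent polynomial.
  -- Only the components of `g m` in codimension `i + 1` are kept; the others do not reach cells of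
  -- codimension `i`.
  let G : {τ : Cell C v // τ.codim = i + 1} → AddMonoidAlgebra k L := fun τ =>
    ∑ m ∈ s, AddMonoidAlgebra.single m (g m τ)
  have hG : ∀ τ m, (G τ).coeff m = if m ∈ s then g m τ else 0 := by
    intro τ m
    simp [G, AddMonoidAlgebra.coeff_sum, Finsupp.finsetSum_apply, Finsupp.single_apply]
  refine ⟨multHom (i + 1) G fun τ m hm => ?_, ?_⟩
  · rw [Finsupp.mem_support_iff, hG] at hm
    split_ifs at hm
    · exact hg m τ hm
    · exact absurd rfl hm
  · refine LinearMap.ext fun a => funext fun τ => Subtype.ext ?_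
    rw [coe_homDiff o (coe_multHom G _), hF]
    congr 1
    refine AddMonoidAlgebra.coeff_injective (Finsupp.ext fun m => ?_)
    rw [coeff_sum_incidence_smul]
    by_cases hm : m ∈ s
    · rw [← coeffAt_of_codim F m τ, ← hgd m]
      rw [cellDiff_apply, cellDiff_apply]
      refine Finset.sum_congr rfl fun τ' _ => ?_
      by_cases h : τ'.codim = i + 1
      · rw [coeffAt, dif_pos h, hG, if_pos hm]
      · have : incidence o τ' τ = 0 := by
          by_contra hi
          have := (incidence_ne_zero hi).2
          have := τ.2
          omega
        rw [this, Int.cast_zero, zero_mul, zero_mul]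
    · have h1 : (F τ).coeff m = 0 := by
        by_contra h
        exact hm (Finset.mem_biUnion.2 ⟨τ, Finset.mem_univ _, Finsupp.mem_support_iff.2 h⟩)
      rw [h1]
      refine cellDiff_eq_zero_of fun τ' h => absurd ?_ h
      unfold coeffAt
      split_ifs
      · rw [hG, if_neg hm]
      · rfl

/-! ### The top cell and the homology in the degree of an isomorphism -/

theorem Cell.codim_eq_zero_iff {τ : Cell C v} : τ.codim = 0 ↔ τ.Ω = Set.univ := by
  have hfin := τ.codim_add_finrank
  constructor
  · intro h
    have htop : τ.dir = ⊤ := Submodule.eq_top_of_finrank_eq (by omega)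
    refine Set.eq_univ_of_forall fun n => ?_
    by_contra hn
    obtain ⟨m, -, hm⟩ := C.exists_normal_eq_one n.2
    have := mem_dir.1 (htop ▸ Submodule.mem_top : m ∈ τ.dir) n hn
    linarith
  · intro h
    have htop : τ.dir = ⊤ := eq_top_iff.2 fun t _ => mem_dir.2 fun n hn =>
      absurd (h ▸ Set.mem_univ n) hn
    rw [htop, finrank_top] at hfin
    omega

variable (C v) in
/-- The open cell of full dimension. -/
def topCell : {τ : Cell C v // τ.codim = 0} :=
  ⟨exists_cell_univ.choose, Cell.codim_eq_zero_iff.2 exists_cell_univ.choose_spec⟩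

theorem eq_topCell (τ : {τ : Cell C v // τ.codim = 0}) : τ = topCell C v :=
  Subtype.ext (Cell.eq_of_Ω_eq ((Cell.codim_eq_zero_iff.1 τ.2).trans
    (Cell.codim_eq_zero_iff.1 (topCell C v).2).symm))

theorem subsingleton_homHomology_of_not_equiv (o : CellOrientations C v)
    (h : ∀ m, ¬ IsShift C v v' m) (i : ℕ) : Subsingleton (homHomology k o v' i) := by
  refine subsingleton_homHomology o fun φ hφ => ?_
  obtain ⟨F, hFs, hF⟩ := exists_multipliers φ
  exact mem_homBoundaries_of_cycle o hφ hFs hF fun m hm => absurd hm (h m)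

/-- The only possible obstruction sits in the degree of an isomorphism, where the strand contains
only the top cell, of codimension zero. -/
theorem subsingleton_homHomology_of_ne_zero (o : CellOrientations C v) {i : ℕ} (hi : i ≠ 0) :
    Subsingleton (homHomology k o v' i) := by
  refine subsingleton_homHomology o fun φ hφ => ?_
  obtain ⟨F, hFs, hF⟩ := exists_multipliers φ
  refine mem_homBoundaries_of_cycle o hφ hFs hF fun m hm τ => ?_
  by_contra h
  have h1 := Cell.codim_eq_zero_iff.2
    (Cell.Ω_eq_univ_of_isShift hm (hFs τ m (Finsupp.mem_support_iff.2 h)))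
  exact hi (τ.2 ▸ h1)

/-- The coefficient in degree `m` of a homomorphism to the term of degree zero, computed on the
monomial `x ^ p`. -/
def topCoeff (m : L) (p : L) (hp : AddMonoidAlgebra.single p (1 : k) ∈ conicModule k C v') :
    homTerm k C v v' 0 →ₗ[k] k where
  toFun φ := (φ ⟨_, hp⟩ (topCell C v) : AddMonoidAlgebra k L).coeff (m + p)
  map_add' _ _ := rfl
  map_smul' _ _ := rfl

theorem topCoeff_eq (m : L) {p : L} (hp : AddMonoidAlgebra.single p (1 : k) ∈ conicModule k C v')
    {φ : homTerm k C v v' 0} {F : {τ : Cell C v // τ.codim = 0} → AddMonoidAlgebra k L}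
    (hF : ∀ a τ, (φ a τ : AddMonoidAlgebra k L) = F τ * (a : AddMonoidAlgebra k L)) :
    topCoeff m p hp φ = (F (topCell C v)).coeff m := by
  change (φ ⟨_, hp⟩ (topCell C v) : AddMonoidAlgebra k L).coeff (m + p) = _
  rw [hF, AddMonoidAlgebra.coeff_mul_single_add, mul_one]

/-- Nothing of codimension one maps into degree `m`, and all other degrees are exact; so the
coefficient of `x^m` on the top cell is the only invariant of a class. The computation of the
homology and of its grading rests on this. -/
theorem mem_homBoundaries_zero_iff (o : CellOrientations C v) {m : L} (hm : IsShift C v v' m)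
    {p : L} (hp : AddMonoidAlgebra.single p (1 : k) ∈ conicModule k C v')
    (φ : homTerm k C v v' 0) : φ ∈ homBoundaries k o v' 0 ↔ topCoeff m p hp φ = 0 := by
  constructor
  · rintro ⟨ψ, rfl⟩
    obtain ⟨G, hGs, hG⟩ := exists_multipliers ψ
    rw [topCoeff_eq m hp (coe_homDiff o hG), coeff_sum_incidence_smul]
    refine cellDiff_eq_zero_of fun τ' h => absurd ?_ h
    unfold coeffAt
    split_ifs with h'
    · by_contra h0
      have := Cell.codim_eq_zero_iff.2
        (Cell.Ω_eq_univ_of_isShift hm (hGs ⟨τ', h'⟩ m (Finsupp.mem_support_iff.2 h0)))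
      change τ'.codim = 0 at this
      omega
    · rfl
  · intro h
    obtain ⟨F, hFs, hF⟩ := exists_multipliers φ
    refine mem_homBoundaries_of_cycle o (i := 0) trivial hFs hF fun m' hm' τ => ?_
    rw [topCoeff_eq m hp hF] at h
    rw [hm.eq hm', eq_topCell τ, h]

/-- The homomorphism of degree `m` to the term of degree zero. -/
theorem exists_topCoeff_eq {m : L} (hm : IsShift C v v' m)
    {p : L} (hp : AddMonoidAlgebra.single p (1 : k) ∈ conicModule k C v') (c : k) :
    ∃ φ ∈ homGraded k C v v' 0 m, topCoeff m p hp φ = c := by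
  refine ⟨multHom 0 (fun _ => AddMonoidAlgebra.single m c) fun τ q hq n => ?_, ?_, ?_⟩
  · rw [Finset.mem_singleton.1 (Finsupp.support_single_subset hq), ← hm n, Cell.bound,
      if_pos (Cell.codim_eq_zero_iff.1 τ.2 ▸ Set.mem_univ n), add_zero]
  · intro q a ha τ
    rw [coe_multHom]
    rw [AddMonoidAlgebra.grade_eq_lsingle_range] at ha
    obtain ⟨b, hb⟩ := ha
    rw [← hb]
    change AddMonoidAlgebra.single m c * AddMonoidAlgebra.single q b ∈ _
    rw [AddMonoidAlgebra.single_mul_single, add_comm]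
    exact AddMonoidAlgebra.single_mem_grade _ _
  · rw [topCoeff_eq m hp (coe_multHom _ _)]
    simp

theorem finrank_homHomology_zero (o : CellOrientations C v) {m : L} (hm : IsShift C v v' m) :
    Module.finrank k (homHomology k o v' 0) = 1 := by
  obtain ⟨p, hp⟩ := exists_single_mem_conicModule k C v'
  let ℓ : homCycles k o v' 0 →ₗ[k] k := topCoeff m p hp ∘ₗ (homCycles k o v' 0).subtype
  have hker : (homBoundaries k o v' 0).submoduleOf (homCycles k o v' 0) = LinearMap.ker ℓ :=
    Submodule.ext fun φ => mem_homBoundaries_zero_iff o hm hp φ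
  have hsurj : Function.Surjective ℓ := fun c => by
    obtain ⟨φ, -, hφ⟩ := exists_topCoeff_eq hm hp c
    exact ⟨⟨φ, trivial⟩, hφ⟩
  rw [((Submodule.quotEquivOfEq _ _ hker).trans
    (ℓ.quotKerEquivOfSurjective hsurj)).finrank_eq, Module.finrank_self]

theorem homologyGraded_eq_top (o : CellOrientations C v) {m : L} (hm : IsShift C v v' m) :
    homologyGraded k o v' 0 m = ⊤ := by
  obtain ⟨p, hp⟩ := exists_single_mem_conicModule k C v'
  refine eq_top_iff.2 fun q _ => ?_
  obtain ⟨φ, rfl⟩ := Submodule.mkQ_surjective _ q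
  obtain ⟨ψ, hψ, hψc⟩ := exists_topCoeff_eq hm hp (topCoeff m p hp φ.1)
  refine ⟨⟨ψ, trivial⟩, hψ, ?_⟩
  refine (Submodule.Quotient.eq _).2 ?_
  refine (mem_homBoundaries_zero_iff o hm hp (ψ - φ.1)).2 ?_
  rw [map_sub, hψc, sub_self]

theorem homologyGraded_eq_bot (o : CellOrientations C v) {m : L} (hm : IsShift C v v' m) {n : L}
    (hn : n ≠ m) : homologyGraded k o v' 0 n = ⊥ := by
  obtain ⟨p, hp⟩ := exists_single_mem_conicModule k C v'
  refine eq_bot_iff.2 ?_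
  rintro _ ⟨φ, hφ, rfl⟩
  refine (Submodule.Quotient.mk_eq_zero _).2 ?_
  refine (mem_homBoundaries_zero_iff o hm hp φ.1).2 ?_
  -- The image of `x^p` is homogeneous of degree `p + n`, so its coefficient in degree `m + p` is
  -- zero when `n ≠ m`.
  have h := hφ p ⟨_, hp⟩ (AddMonoidAlgebra.single_mem_grade _ _) (topCell C v)
  rw [AddMonoidAlgebra.mem_grade_iff] at h
  by_contra h0
  have h1 := Finset.mem_singleton.1 (h (Finsupp.mem_support_iff.2 h0))
  rw [add_comm p n, add_left_inj] at h1
  exact hn h1.symm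

end HomComplex

end ConicAcyclicity

end

/-! ### The acyclicity lemma -/

open ConicAcyclicity in
theorem lemma5p2 {E : Type*} [NormedAddCommGroup E] [NormedSpace ℝ E] [FiniteDimensional ℝ E]
    (L : Submodule ℤ E) [DiscreteTopology L] [IsZLattice ℝ L] (k : Type*) [Field k]
    (C : ToricCone L) (v v' : E) (o : CellOrientations C v) :
    -- `K_Δ`, hence `Hom_R(A_Δ', K_Δ)`, is a complex
    (∀ i, chainDiff k o i ∘ₗ chainDiff k o (i + 1) = 0) ∧
    -- exactness when `A_Δ` and `A_Δ'` are not isomorphic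
    (¬ Nonempty (conicModule k C v ≃ₗ[toricAlgebra k C] conicModule k C v') →
      ∀ i, Subsingleton (homHomology k o v' i)) ∧
    -- homology when `A_Δ` and `A_Δ'` are isomorphic
    (Nonempty (conicModule k C v ≃ₗ[toricAlgebra k C] conicModule k C v') →
      ∃ m : L, chamber C v = (fun x => (m : E) + x) '' chamber C v' ∧
        (∀ m' : L, chamber C v = (fun x => (m' : E) + x) '' chamber C v' → m' = m) ∧
        (∀ i, i ≠ 0 → Subsingleton (homHomology k o v' i)) ∧
        Module.finrank k (homHomology k o v' 0) = 1 ∧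
        homologyGraded k o v' 0 m = ⊤ ∧
        ∀ n : L, n ≠ m → homologyGraded k o v' 0 n = ⊥) := by
  refine ⟨chainDiff_comp_chainDiff o, fun h => ?_, fun h => ?_⟩
  · rw [nonempty_equiv_iff_exists_isShift, not_exists] at h
    exact subsingleton_homHomology_of_not_equiv o h
  · obtain ⟨m, hm⟩ := nonempty_equiv_iff_exists_isShift.1 h
    exact ⟨m, (chamber_eq_image_iff m).2 hm,
      fun m' h' => hm.eq ((chamber_eq_image_iff m').1 h'),
      fun i hi => subsingleton_homHomology_of_ne_zero o hi, finrank_homHomology_zero o hm,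
      homologyGraded_eq_top o hm, fun n hn => homologyGraded_eq_bot o hm hn⟩
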